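/- **The model.** Let $d\ge 1$, let $\|\cdot\|$ be the Euclidean norm, let $\lambda>0$, $\alpha>d$, $\tau>1$, and assume $\gamma:=\alpha(\tau-1)/d\in(1,2)$. Let $W$ be a random variable with $\mathbb P(W\ge 1)=1$ and $\mathbb P(W>t)=\ell(t)/t^{\tau-1}$ for $t>0$, where $\ell$ varies slowly at infinity, i.e. $\ell(ct)/\ell(t)\to1$ as $t\to\infty$ for every $c>0$. Let $L\ge 0$ be a real random variable with distribution function $F_L(t)=\mathbb P(L\le t)$ and generalised inverse $F_L^{(-1)}(u)=\inf\{t\in\mathbb R: F_L(t)\ge u\}$. In the weighted scale-free percolation model $\mathrm{SFP}_{W,L}$ on $\mathbb Z^d$ the vertices $x\in\mathbb Z^d$ carry i.i.d. vertex-weights $W_x$ distributed as $W$. Conditionally on $(W_x)_{x\in\mathbb Z^d}$, edges are present independently: $\{x,y\}$ is present with probability $1$ if $\|x-y\|=1$, and with probability $1-\exp(-\lambda W_xW_y/\|x-y\|^{\alpha})$ if $\|x-y\|>1$. The edges $e$ of the resulting graph then receive i.i.d. edge-weights $L_e$ distributed as $L$, independent of the vertex-weights and the graph. Let $d_G$ be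 the graph distance and $d_L(x,y)=\inf_{\pi}\sum_{e\in\pi}L_e$, the infimum over all paths $\pi$ from $x$ to $y$. For $x\in\mathbb Z^d$ and $n\in\mathbb N$ put $$\tau_n(x)=\inf\bigl\{t\ge 0: |\{y: d_L(x,y)\le t\}|\ge n\bigr\},\qquad M_n(x)=\inf\{d_L(x,y): d_G(x,y)=n\},$$ (with $\inf\emptyset=\infty$), and let $$\mathbf I(L)=\int_0^\infty F_L^{(-1)}\bigl(\exp(-e^{y})\bigr)\,dy .$$ **Theorem.** Let $x\in\mathbb Z^d$ be fixed. 1. (Explosive part) If $\mathbf I(L)<\infty$, then there is an almost surely finite random variable $V_x$ (the explosion time of $x$) such that, as $n\to\infty$, $\tau_n(x)\to V_x$ and $M_n(x)\to V_x$ almost surely. 2. (Conservative part) If $\mathbf I(L)=\infty$, then, as $n\to\infty$, $\tau_n(x)\to\infty$ and $M_n(x)\to\infty$ almost surely, and moreover $$\frac{M_n(x)}{\sum_{k=1}^{n}F_L^{(-1)}\Bigl(\exp\bigl(-(1/(\gamma-1))^{k}\bigr)\Bigr)}\longrightarrow 1\qquad\text{almost surely.}$$ -/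

import Mathlib

open MeasureTheory ProbabilityTheory Filter Topology
open scoped NNReal ENNReal

noncomputable section

namespace SFP

/-- The Euclidean distance of two points of `ℤ^d`. -/
def latticeDist {d : ℕ} (x y : Fin d → ℤ) : ℝ :=
  ‖(WithLp.toLp 2 fun i => ((x i : ℝ) - (y i : ℝ)) : EuclideanSpace ℝ (Fin d))‖

theorem latticeDist_comm {d : ℕ} (x y : Fin d → ℤ) : latticeDist x y = latticeDist y x := by
  unfold latticeDist
  rw [← norm_neg]
  congr 1
  ext i
  simp

/-- The probability that the edge `e = {x, y}` is present, given the vertex-weights `w`: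
it is `1` for nearest neighbours, and `1 - exp (-lam * w x * w y / ‖x - y‖ ^ α)` otherwise. -/
def connProb {d : ℕ} (lam α : ℝ) (w : (Fin d → ℤ) → ℝ) : Sym2 (Fin d → ℤ) → ℝ :=
  Sym2.lift ⟨fun x y =>
    if latticeDist x y = 1 then 1
    else 1 - Real.exp (-(lam * (w x * w y) / latticeDist x y ^ α)), fun x y => by
      simp only [latticeDist_comm x y, mul_comm (w x) (w y)]⟩

/-- The `σ`-algebra generated by the vertex-weights. -/
abbrev weightSigma {d : ℕ} {Ω : Type*} (W : (Fin d → ℤ) → Ω → ℝ) : MeasurableSpace Ω :=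
  MeasurableSpace.comap (fun ω x => W x ω) inferInstance

/-- `(W, G, L)`, defined on the probability space `(Ω, μ)`, is a weighted scale-free percolation
on `ℤ^d` with percolation parameter `lam`, long-range parameter `α`, vertex-weight law `PW` and
edge-weight law `PL`: the vertex-weights `W x` are i.i.d. with law `PW`; given the vertex-weights,
the edges of the random graph `G` are independently present, each with probability `connProb`;
the edge-weights `L e` are i.i.d. with law `PL`, independent of the vertex-weights and the graph
(only the `L e` of edges `e` of the graph are ever used). -/
structure IsWeightedScaleFreePercolation {d : ℕ} {Ω : Type*} [MeasurableSpace Ω] (μ : Measure Ω)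
    (lam α : ℝ) (PW PL : Measure ℝ) (W : (Fin d → ℤ) → Ω → ℝ)
    (G : Ω → SimpleGraph (Fin d → ℤ)) (L : Sym2 (Fin d → ℤ) → Ω → ℝ) : Prop where
  measurable_weight : ∀ x, Measurable (W x)
  indep_weight : iIndepFun W μ
  law_weight : ∀ x, μ.map (W x) = PW
  measurableSet_edge : ∀ e, MeasurableSet {ω | e ∈ (G ω).edgeSet}
  cond_edge : ∀ S : Finset (Sym2 (Fin d → ℤ)), (∀ e ∈ S, ¬ e.IsDiag) →
    μ⟦{ω | ∀ e ∈ S, e ∈ (G ω).edgeSet} | weightSigma W⟧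
      =ᵐ[μ] fun ω => ∏ e ∈ S, connProb lam α (fun x => W x ω) e
  measurable_length : ∀ e, Measurable (L e)
  indep_length : iIndepFun L μ
  law_length : ∀ e, μ.map (L e) = PL
  indep_length_graph :
    IndepFun (fun ω e => L e ω)
      (fun ω => ((fun x => W x ω : (Fin d → ℤ) → ℝ),
        (fun e => e ∈ (G ω).edgeSet : Sym2 (Fin d → ℤ) → Prop))) μ

section Graph

variable {V : Type*}

/-- The `L`-length of a walk. -/
def walkLength (G : SimpleGraph V) (len : Sym2 V → ℝ) {x y : V} (p : G.Walk x y) : ℝ≥0∞ :=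
  (p.edges.map fun e => ENNReal.ofReal (len e)).sum

/-- The `L`-distance: the infimum of the `L`-lengths of the paths from `x` to `y`. -/
def lDist (G : SimpleGraph V) (len : Sym2 V → ℝ) (x y : V) : ℝ≥0∞ :=
  ⨅ p : G.Path x y, walkLength G len (p : G.Walk x y)

/-- The closed ball of radius `t` around `x` for the `L`-distance. -/
def lBall (G : SimpleGraph V) (len : Sym2 V → ℝ) (x : V) (t : ℝ≥0) : Set V :=
  {y | lDist G len x y ≤ t}

/-- The set of the vertices at graph distance exactly `n` from `x`. -/
def graphSphere (G : SimpleGraph V) (x : V) (n : ℕ) : Set V :=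
  {y | G.edist x y = n}

/-- The first time `t` at which the `L`-ball around `x` contains (at least) `n` vertices. -/
def hitCount (G : SimpleGraph V) (len : Sym2 V → ℝ) (x : V) (n : ℕ) : ℝ≥0∞ :=
  ⨅ (t : ℝ≥0) (_ : (n : ℕ∞) ≤ (lBall G len x t).encard), (t : ℝ≥0∞)

/-- The `L`-distance from `x` to the vertices at graph distance `n`. -/
def hitSphere (G : SimpleGraph V) (len : Sym2 V → ℝ) (x : V) (n : ℕ) : ℝ≥0∞ :=
  ⨅ y ∈ graphSphere G x n, lDist G len x y

end Graph

/-- The generalised inverse of the distribution function of the law `P`. -/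
def quantile (P : Measure ℝ) (u : ℝ) : ℝ := sInf {t : ℝ | u ≤ cdf P t}

/-- The integral `∫₀^∞ F⁻¹(exp(-e^y)) dy`. -/
def explosionIntegral (P : Measure ℝ) : ℝ≥0∞ :=
  ∫⁻ y in Set.Ioi (0 : ℝ), ENNReal.ofReal (quantile P (Real.exp (-Real.exp y)))

/-- `ℓ` varies slowly at infinity. -/
def SlowlyVarying (ℓ : ℝ → ℝ) : Prop :=
  ∀ c : ℝ, 0 < c → Tendsto (fun t => ℓ (c * t) / ℓ t) atTop (𝓝 1)

end SFP

end

/-!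
Write `θ = τ - 1`, `γ = α θ / d ∈ (1, 2)`, `a = 1 / (γ - 1) > 1`, and `h y = F⁻¹(exp (-e ^ y))`, a
nonincreasing function. The weights in the ball of radius `n` of the graph distance around `x` grow
like `exp (a ^ n)`, up to an arbitrarily small change of `a`; hence about as many edges lead from
level `n - 1` to level `n`, and the cheapest of them costs `F⁻¹(exp (-a ^ n)) = h (n log a)`. The
distance to the sphere of radius `n` is therefore about `∑ k ≤ n, h (k log a)`, which differs from
`(log a)⁻¹ ∫₀^(n log a) h` by a bounded amount. Since `h` is nonincreasing, changing `a` slightly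
changes this integral by a factor close to `1`; constant factors in front of `a ^ n` are absorbed
in a bounded error.

*Lower bound* (`ae_exists_weight_le`, `ae_exists_length_ge`, for `b > a`). A first moment bound over
the self-avoiding paths `x = v₀, …, v_k` with weights at most `u_i = exp (b ^ (i + j))`, except
possibly the last. The interpolation `1 - exp (-t) ≤ t ^ s` with `s` slightly above `d / α` bounds
the connection probability of `y` and `z` by a constant times `(W_y W_z) ^ s f (z - y)` with a
summable function `f`, so that the expected number of paths factorises. The moment
`E[W ^ β]` is finite for `β < θ`, and truncation turns `W_i ^ (2 s)` into
`u_i ^ (2 s - β) W_i ^ β`. The gain from a last weight above its threshold beats the losses from the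
truncations exactly if `(b + 1) s < b β`, which is possible since `b > a`. So no geodesic violates
the thresholds, for some `j`; and the same count, with a short last edge instead of a high last
weight, shows that the edges from level `k - 1` to level `k` cost at least `F⁻¹(exp (-c b ^ k))`
eventually. As the graph distance changes by at most one along an edge, these costs add up
(`sum_le_hitSphere`).

*Upper bound* (`ae_eventually_exists_greedy_step`, `ae_exists_lDist_le`, for `1 < b < a`). Consider
the cubes of side `exp (ρ b ^ k)` with `ρ = (1 + b) / (α b)`. The side is chosen so that vertices of
weights `exp (b ^ k)` and `exp (b ^ (k + 1))` in consecutive cubes are connected with probability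
bounded below, and `b < a` ensures that there are at least `exp (2 η b ^ k)` such vertices, for some
`η > 0`. Hence a given vertex of high weight has a neighbour of the next weight at cost at most
`F⁻¹(exp (-η b ^ (k + 1)))` except with a probability that is doubly exponentially small in
`b ^ k`, and a union bound over the cube removes all dependence between successive steps. Following
these edges gives a path from `x` whose length is a sum of quantiles; by the upper bound on the
weights, it leaves the ball of radius `n` after about `n` steps.

Both bounds together are `ae_exists_hitSphere_bounds`. If the integral of `h` is finite, the
distances to the spheres stay bounded; otherwise they are asymptotic to the sum of quantiles. As the
graph is locally finite, the limits of the two hitting times agree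
(`iSup_hitCount_eq_iSup_hitSphere`).
-/

namespace SFP

/-! ### Regularly varying tails -/

/-- The tail `T t = ℓ t / t ^ θ` satisfies `T (2 t) / T t → 2 ^ (-θ)`. -/
theorem tendsto_tail_doubling {ℓ T : ℝ → ℝ} {θ : ℝ} (hℓ : SlowlyVarying ℓ)
    (hT : ∀ t : ℝ, 0 < t → T t = ℓ t / t ^ θ) :
    Tendsto (fun t => T (2 * t) / T t) atTop (𝓝 ((2 : ℝ) ^ (-θ))) := by
  have h := (hℓ 2 two_pos).mul_const ((2 : ℝ) ^ (-θ))
  rw [one_mul] at h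
  refine h.congr' ?_
  filter_upwards [eventually_gt_atTop 0] with t ht
  rw [hT t ht, hT (2 * t) (by positivity), Real.mul_rpow two_pos.le ht.le,
    Real.rpow_neg two_pos.le]
  have h2 : (2 : ℝ) ^ θ ≠ 0 := by positivity
  have h3 : t ^ θ ≠ 0 := by positivity
  by_cases h0 : ℓ t = 0
  · simp [h0]
  · field_simp

/-- A regularly varying tail of index `-θ` decays more slowly than `t ^ (-θ')` for `θ' > θ`: compare
along the powers of `2` and use monotonicity in between. -/
theorem exists_le_tail {ℓ T : ℝ → ℝ} {θ θ' : ℝ} (hℓ : SlowlyVarying ℓ)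
    (hT : ∀ t : ℝ, 0 < t → T t = ℓ t / t ^ θ) (hanti : Antitone T) (hnn : ∀ t, 0 ≤ T t)
    (hθ : θ < θ') (hθ0 : 0 < θ) : ∃ c : ℝ, 0 < c ∧ ∀ t : ℝ, 1 ≤ t → c * t ^ (-θ') ≤ T t := by
  have hlt : (2 : ℝ) ^ (-θ') < 2 ^ (-θ) :=
    Real.rpow_lt_rpow_of_exponent_lt one_lt_two (by linarith)
  obtain ⟨t₀, ht₀⟩ := eventually_atTop.1 ((tendsto_tail_doubling hℓ hT).eventually_const_lt hlt)
  set t₁ := max t₀ 1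
  have h1 : (1 : ℝ) ≤ t₁ := le_max_right _ _
  have hpos : ∀ t, t₁ ≤ t → 0 < T t := by
    intro t ht
    -- division by zero gives `0`, which is not close to `2 ^ (-θ)`
    refine lt_of_le_of_ne (hnn t) fun h => ?_
    have := ht₀ t ((le_max_left _ _).trans ht)
    rw [← h, div_zero] at this
    exact absurd this (not_lt.2 (by positivity))
  have hdoub : ∀ t, t₁ ≤ t → 2 ^ (-θ') * T t ≤ T (2 * t) := fun t ht =>
    ((lt_div_iff₀ (hpos t ht)).1 (ht₀ t ((le_max_left _ _).trans ht))).le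
  have hpow : ∀ n : ℕ, ((2 : ℝ) ^ n) ^ (-θ') * T t₁ ≤ T (2 ^ n * t₁) := by
    intro n
    induction n with
    | zero => simp
    | succ n ih =>
      have h2 : t₁ ≤ 2 ^ n * t₁ := le_mul_of_one_le_left (by linarith) (one_le_pow₀ one_le_two)
      have := hdoub _ h2
      rw [pow_succ', Real.mul_rpow two_pos.le (by positivity), mul_assoc, mul_assoc]
      exact (mul_le_mul_of_nonneg_left ih (by positivity)).trans this
  refine ⟨2 ^ (-θ') * T t₁, mul_pos (by positivity) (hpos _ le_rfl), fun t ht => ?_⟩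
  obtain ⟨n, hn1, hn2⟩ := exists_nat_pow_near ht one_lt_two
  calc 2 ^ (-θ') * T t₁ * t ^ (-θ') = 2 ^ (-θ') * t ^ (-θ') * T t₁ := by ring
    _ ≤ 2 ^ (-θ') * ((2 : ℝ) ^ n) ^ (-θ') * T t₁ := by
        gcongr ?_ * ?_ * _
        · exact hnn _
        · exact Real.rpow_le_rpow_of_nonpos (by positivity) hn1 (by linarith)
    _ = ((2 : ℝ) ^ (n + 1)) ^ (-θ') * T t₁ := by
        rw [pow_succ', Real.mul_rpow two_pos.le (by positivity)]
    _ ≤ T (2 ^ (n + 1) * t₁) := hpow _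
    _ ≤ T t := hanti (hn2.le.trans (le_mul_of_one_le_right (by positivity) h1))

/-- A regularly varying tail of index `-θ` decays faster than `t ^ (-θ')` for `θ' < θ`. -/
theorem exists_tail_le {ℓ T : ℝ → ℝ} {θ θ' : ℝ} (hℓ : SlowlyVarying ℓ)
    (hT : ∀ t : ℝ, 0 < t → T t = ℓ t / t ^ θ) (hanti : Antitone T) (hnn : ∀ t, 0 ≤ T t)
    (hθ : θ' < θ) (hθ0 : 0 < θ') : ∃ c : ℝ, 0 < c ∧ ∀ t : ℝ, 1 ≤ t → T t ≤ c * t ^ (-θ') := by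
  have hlt : (2 : ℝ) ^ (-θ) < 2 ^ (-θ') :=
    Real.rpow_lt_rpow_of_exponent_lt one_lt_two (by linarith)
  have hev := ((tendsto_tail_doubling hℓ hT).eventually_lt_const hlt).and
    ((tendsto_tail_doubling hℓ hT).eventually_const_lt
      (show (0 : ℝ) < 2 ^ (-θ) by positivity))
  obtain ⟨t₀, ht₀⟩ := eventually_atTop.1 hev
  set t₁ := max t₀ 1
  have h1 : (1 : ℝ) ≤ t₁ := le_max_right _ _
  have hpos : ∀ t, t₁ ≤ t → 0 < T t := by
    intro t ht
    refine lt_of_le_of_ne (hnn t) fun h => ?_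
    have := (ht₀ t ((le_max_left _ _).trans ht)).2
    rw [← h, div_zero] at this
    exact lt_irrefl _ this
  have hdoub : ∀ t, t₁ ≤ t → T (2 * t) ≤ 2 ^ (-θ') * T t := fun t ht =>
    ((div_lt_iff₀ (hpos t ht)).1 (ht₀ t ((le_max_left _ _).trans ht)).1).le
  have hpow : ∀ n : ℕ, T (2 ^ n * t₁) ≤ ((2 : ℝ) ^ n) ^ (-θ') * T t₁ := by
    intro n
    induction n with
    | zero => simp
    | succ n ih =>
      have h2 : t₁ ≤ 2 ^ n * t₁ := le_mul_of_one_le_left (by linarith) (one_le_pow₀ one_le_two)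
      have := hdoub _ h2
      rw [pow_succ', Real.mul_rpow two_pos.le (by positivity), mul_assoc, mul_assoc]
      exact this.trans (mul_le_mul_of_nonneg_left ih (by positivity))
  have hT1 : T t₁ ≤ T 1 := hanti h1
  refine ⟨(2 * t₁) ^ θ' * T 1, mul_pos (by positivity) ((hpos _ le_rfl).trans_le hT1),
    fun t ht => ?_⟩
  have hkey : ∀ r : ℝ, 0 < r → t ≤ 2 * t₁ * r → r ^ (-θ') ≤ (2 * t₁) ^ θ' * t ^ (-θ') := by
    intro r hr htr
    rw [Real.rpow_neg hr.le, Real.rpow_neg (by linarith), ← div_eq_mul_inv,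
      inv_le_iff_one_le_mul₀ (by positivity), div_mul_eq_mul_div, one_le_div (by positivity),
      ← Real.mul_rpow (by positivity) hr.le]
    exact Real.rpow_le_rpow (by linarith) htr hθ0.le
  rcases le_total t t₁ with htt | htt
  · have := hkey 1 one_pos (by linarith)
    rw [Real.one_rpow] at this
    calc T t ≤ 1 * T 1 := by rw [one_mul]; exact hanti ht
      _ ≤ (2 * t₁) ^ θ' * t ^ (-θ') * T 1 := by gcongr; exact hnn _
      _ = _ := by ring
  · obtain ⟨n, hn1, hn2⟩ := exists_nat_pow_near (x := t / t₁) (y := 2)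
      ((one_le_div (by linarith)).2 htt) one_lt_two
    rw [le_div_iff₀ (by linarith)] at hn1
    rw [div_lt_iff₀ (by linarith)] at hn2
    have := hkey (2 ^ n) (by positivity) (by rw [pow_succ] at hn2; linarith)
    calc T t ≤ T (2 ^ n * t₁) := hanti hn1
      _ ≤ ((2 : ℝ) ^ n) ^ (-θ') * T t₁ := hpow _
      _ ≤ (2 * t₁) ^ θ' * t ^ (-θ') * T 1 := by gcongr; exact hnn _
      _ = _ := by ring

/-- A law on `[1, ∞)` with regularly varying tail of index `-θ` has a finite moment of every
order `β < θ`. -/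
theorem lintegral_rpow_lt_top {P : Measure ℝ} [IsProbabilityMeasure P] {ℓ : ℝ → ℝ} {θ β : ℝ}
    (hℓ : SlowlyVarying ℓ) (htail : ∀ t : ℝ, 0 < t → P.real (Set.Ioi t) = ℓ t / t ^ θ)
    (h1 : ∀ᵐ w ∂P, 1 ≤ w) (hβ0 : 0 < β) (hβ : β < θ) :
    ∫⁻ w, ENNReal.ofReal (w ^ β) ∂P < ∞ := by
  obtain ⟨θ', hβθ, hθ'⟩ := exists_between hβ
  obtain ⟨c, hc, htl⟩ := exists_tail_le (T := fun t => P.real (Set.Ioi t)) hℓ htail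
    (fun s t hst => measureReal_mono (Set.Ioi_subset_Ioi hst)) (fun t => measureReal_nonneg)
    hθ' (hβ0.trans hβθ)
  rw [lintegral_rpow_eq_lintegral_meas_lt_mul P (f := fun w => w)
    (h1.mono fun w hw => zero_le_one.trans hw) aemeasurable_id hβ0]
  refine ENNReal.mul_lt_top ENNReal.ofReal_lt_top ?_
  rw [← Set.Ioc_union_Ioi_eq_Ioi zero_le_one, lintegral_union measurableSet_Ioi
    (Set.disjoint_left.2 fun t h h' => not_lt.2 h.2 h')]
  refine ENNReal.add_lt_top.2 ⟨?_, ?_⟩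
  · calc ∫⁻ t in Set.Ioc (0 : ℝ) 1, P {a | t < a} * ENNReal.ofReal (t ^ (β - 1))
        ≤ ∫⁻ t in Set.Ioc (0 : ℝ) 1, ENNReal.ofReal (t ^ (β - 1)) := by
          refine lintegral_mono fun t => ?_
          exact mul_le_of_le_one_left zero_le prob_le_one
      _ < ∞ := by
          have := (intervalIntegral.intervalIntegrable_rpow' (a := 0) (b := 1)
            (r := β - 1) (by linarith))
          rw [intervalIntegrable_iff_integrableOn_Ioc_of_le zero_le_one] at this
          exact this.lintegral_lt_top
  · calc ∫⁻ t in Set.Ioi (1 : ℝ), P {a | t < a} * ENNReal.ofReal (t ^ (β - 1))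
        ≤ ∫⁻ t in Set.Ioi (1 : ℝ), ENNReal.ofReal (c * t ^ (β - θ' - 1)) := by
          refine setLIntegral_mono' measurableSet_Ioi fun t ht => ?_
          have ht : (1 : ℝ) < t := ht
          have h2 := htl t ht.le
          have h3 : P {a | t < a} = ENNReal.ofReal (P.real (Set.Ioi t)) := by
            rw [measureReal_def, ENNReal.ofReal_toReal (measure_ne_top _ _)]; rfl
          rw [h3, ← ENNReal.ofReal_mul measureReal_nonneg]
          refine ENNReal.ofReal_le_ofReal ?_
          calc P.real (Set.Ioi t) * t ^ (β - 1) ≤ c * t ^ (-θ') * t ^ (β - 1) := by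
                gcongr
            _ = c * t ^ (β - θ' - 1) := by
                rw [mul_assoc, ← Real.rpow_add (by linarith)]; congr 2; ring
      _ < ∞ := ((integrableOn_Ioi_rpow_of_lt (by linarith) one_pos).const_mul c).lintegral_lt_top

/-! ### Quantiles -/

section Quantile

variable {P : Measure ℝ} [IsProbabilityMeasure P]

theorem cdf_eq_zero_of_neg (hP : ∀ᵐ s ∂P, 0 ≤ s) {t : ℝ} (ht : t < 0) : cdf P t = 0 := by
  rw [cdf_eq_real, measureReal_def, ENNReal.toReal_eq_zero_iff]
  left
  refine measure_mono_null (fun s (hs : s ≤ t) => ?_) hP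
  exact not_le.2 (lt_of_le_of_lt hs ht)

theorem quantile_set_bddBelow (hP : ∀ᵐ s ∂P, 0 ≤ s) {u : ℝ} (hu : 0 < u) :
    (0 : ℝ) ∈ lowerBounds {t : ℝ | u ≤ cdf P t} := by
  intro t ht
  by_contra h
  rw [Set.mem_ofPred_eq, cdf_eq_zero_of_neg hP (not_le.1 h)] at ht
  linarith

omit [IsProbabilityMeasure P] in
theorem quantile_set_nonempty {u : ℝ} (hu : u < 1) : {t : ℝ | u ≤ cdf P t}.Nonempty :=
  ((tendsto_cdf_atTop P).eventually_const_le hu).exists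

theorem quantile_nonneg (hP : ∀ᵐ s ∂P, 0 ≤ s) {u : ℝ} (hu : 0 < u) : 0 ≤ quantile P u :=
  Real.sInf_nonneg (quantile_set_bddBelow hP hu)

theorem quantile_mono (hP : ∀ᵐ s ∂P, 0 ≤ s) {u v : ℝ} (hu : 0 < u) (huv : u ≤ v) (hv : v < 1) :
    quantile P u ≤ quantile P v :=
  csInf_le_csInf ⟨0, quantile_set_bddBelow hP hu⟩ (quantile_set_nonempty hv)
    fun _ ht => huv.trans ht

theorem measureReal_Iio_quantile_le (hP : ∀ᵐ s ∂P, 0 ≤ s) {u : ℝ} (hu : 0 < u) :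
    P.real (Set.Iio (quantile P u)) ≤ u := by
  have hlt : ∀ t < quantile P u, cdf P t ≤ u := fun t ht =>
    (not_le.1 fun h => absurd (csInf_le ⟨0, quantile_set_bddBelow hP hu⟩ h) (not_le.2 ht)).le
  obtain ⟨v, hv, hv1, hv2⟩ := exists_seq_strictMono_tendsto (quantile P u)
  have hU : Set.Iio (quantile P u) = ⋃ n, Set.Iic (v n) := by
    ext s
    simp only [Set.mem_Iio, Set.mem_iUnion, Set.mem_Iic]
    refine ⟨fun hs => ?_, fun ⟨n, hn⟩ => hn.trans_lt (hv1 n)⟩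
    exact ((hv2.eventually_const_lt hs).exists).imp fun n h => h.le
  have hlim := tendsto_measure_iUnion_atTop (μ := P)
    (s := fun n => Set.Iic (v n)) (fun m n hmn => Set.Iic_subset_Iic.2 (hv.monotone hmn))
  rw [← hU] at hlim
  have := (ENNReal.tendsto_toReal (measure_ne_top P _)).comp hlim
  refine le_of_tendsto this (Eventually.of_forall fun n => ?_)
  have := hlt (v n) (hv1 n)
  rwa [cdf_eq_real] at this

theorem le_measureReal_Iic_quantile {u : ℝ} (hu1 : u < 1) :
    u ≤ P.real (Set.Iic (quantile P u)) := by
  rw [← cdf_eq_real]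
  have hrc : Tendsto (cdf P) (𝓝[>] (quantile P u)) (𝓝 (cdf P (quantile P u))) :=
    ((cdf P).right_continuous _).mono Set.Ioi_subset_Ici_self
  refine ge_of_tendsto hrc ?_
  filter_upwards [self_mem_nhdsWithin] with t ht
  obtain ⟨s, hs, hst⟩ := exists_lt_of_csInf_lt (quantile_set_nonempty hu1) ht
  exact le_trans hs (monotone_cdf P hst.le)

end Quantile

/-! ### Sums and integrals of quantiles -/

/-- The function `h y = F⁻¹(exp (-e ^ y))`, whose integral over `(0, ∞)` decides about explosion. -/
noncomputable def expQuantile (P : Measure ℝ) (y : ℝ) : ℝ := quantile P (Real.exp (-Real.exp y))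

section

variable {P : Measure ℝ} [IsProbabilityMeasure P]

theorem expQuantile_nonneg (hP : ∀ᵐ s ∂P, 0 ≤ s) (y : ℝ) : 0 ≤ expQuantile P y :=
  quantile_nonneg hP (Real.exp_pos _)

theorem expQuantile_antitone (hP : ∀ᵐ s ∂P, 0 ≤ s) : Antitone (expQuantile P) := fun x y hxy =>
  quantile_mono hP (Real.exp_pos _) (Real.exp_le_exp.2 (neg_le_neg (Real.exp_le_exp.2 hxy)))
    (by simpa using Real.exp_pos x)

omit [IsProbabilityMeasure P] in
theorem quantile_exp_neg_mul_pow {c b : ℝ} (hc : 0 < c) (hb : 0 < b) (k : ℕ) :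
    quantile P (Real.exp (-(c * b ^ k))) = expQuantile P (k * Real.log b + Real.log c) := by
  rw [expQuantile, Real.exp_add, ← Real.log_pow, Real.exp_log (by positivity), Real.exp_log hc,
    mul_comm]

end

section Antitone

variable {h : ℝ → ℝ} (hh : Antitone h) (hnn : ∀ y, 0 ≤ h y)
include hh

include hnn

theorem abs_integral_shift_le {a c : ℝ} (ha : 0 ≤ a) :
    |∫ y in a..a + c, h y| ≤ h (-|c|) * |c| := by
  have := intervalIntegral.norm_integral_le_of_norm_le_const (a := a) (b := a + c) (f := h)
    (C := h (-|c|)) fun y hy => by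
      rw [Real.norm_of_nonneg (hnn y)]
      refine hh ?_
      rcases le_total 0 c with hc | hc
      · rw [Set.uIoc_of_le (by linarith)] at hy
        have := abs_nonneg c
        linarith [hy.1]
      · rw [Set.uIoc_of_ge (by linarith)] at hy
        rw [abs_of_nonpos hc]
        linarith [hy.1]
  simpa using this

/-- Sums of an antitone function along an arithmetic progression are its integral, up to a
bounded error. -/
theorem exists_abs_sum_sub_integral_le {β : ℝ} (hβ : 0 < β) (c : ℝ) :
    ∃ C : ℝ, ∀ n : ℕ, |β * ∑ k ∈ Finset.Icc 1 n, h (k * β + c) - ∫ y in (0)..(n * β), h y| ≤ C := by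
  refine ⟨2 * (h (-|c|) * |c|) + β * h c, fun n => ?_⟩
  have hg : Antitone fun x : ℝ => h (x * β + c) := fun x y hxy => hh (by gcongr)
  have hsum : ∑ k ∈ Finset.Icc 1 n, h (k * β + c)
      = ∑ i ∈ Finset.range n, h ((0 + ((i + 1 : ℕ) : ℝ)) * β + c) := by
    rw [Finset.range_eq_Ico, Finset.sum_Ico_add' (fun k : ℕ => h ((0 + (k : ℝ)) * β + c)) 0 n 1]
    simp only [zero_add]
    rfl
  have h1 := AntitoneOn.sum_le_integral (x₀ := 0) (a := n) (hg.antitoneOn _)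
  have h2 := AntitoneOn.integral_le_sum (x₀ := 0) (a := n) (hg.antitoneOn _)
  have h3 : ∑ i ∈ Finset.range n, h ((0 + (i : ℝ)) * β + c)
      ≤ ∑ k ∈ Finset.Icc 1 n, h (k * β + c) + h c := by
    have := Finset.sum_range_succ' (fun i : ℕ => h ((0 + (i : ℝ)) * β + c)) n
    rw [← hsum] at this
    rw [Finset.sum_range_succ] at this
    have h4 := hnn ((0 + (n : ℝ)) * β + c)
    simp only [Nat.cast_zero, zero_add, zero_mul] at this h4 ⊢
    linarith
  rw [← hsum] at h1
  have hsub : β * ∫ x in (0 : ℝ)..(0 + n), h (x * β + c) = ∫ y in c..(n * β + c), h y := by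
    simp_rw [mul_comm _ β]
    rw [intervalIntegral.mul_integral_comp_mul_add]
    simp
  have e1 : (∫ y in c..(n * β + c), h y) - ∫ y in (0)..(n * β), h y
      = (∫ y in (n * β)..(n * β + c), h y) - ∫ y in (0)..(0 + c), h y := by
    rw [zero_add, intervalIntegral.integral_interval_sub_interval_comm] <;>
      first | exact hh.intervalIntegrable | skip
    rw [intervalIntegral.integral_symm 0 c, intervalIntegral.integral_symm _ (n * β)]
    ring
  have b1 := abs_integral_shift_le hh hnn (a := n * β) (c := c) (by positivity)
  have b2 := abs_integral_shift_le hh hnn (a := 0) (c := c) le_rfl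
  have m1 := mul_le_mul_of_nonneg_left h1 hβ.le
  have m2 := mul_le_mul_of_nonneg_left (h2.trans h3) hβ.le
  rw [hsub] at m1 m2
  have := abs_le.1 b1
  have := abs_le.1 b2
  have := mul_nonneg hβ.le (hnn c)
  rw [abs_le]
  constructor <;> linarith

theorem integral_mono_right {X Y : ℝ} (hXY : X ≤ Y) :
    ∫ y in (0)..X, h y ≤ ∫ y in (0)..Y, h y := by
  have := intervalIntegral.integral_add_adjacent_intervals
    (hh.intervalIntegrable (μ := volume) (a := 0) (b := X)) (hh.intervalIntegrable (b := Y))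
  have h2 := intervalIntegral.integral_nonneg (μ := volume) hXY fun y _ => hnn y
  linarith

omit hnn in
/-- The integral of an antitone function is concave, whence subhomogeneous. -/
theorem integral_mul_le {r X : ℝ} (hr : 1 ≤ r) (hX : 0 ≤ X) :
    ∫ y in (0)..(r * X), h y ≤ r * ∫ y in (0)..X, h y := by
  have : ∫ y in (0)..(r * X), h y = r * ∫ y in (0)..X, h (r * y) := by
    rw [intervalIntegral.mul_integral_comp_mul_left, mul_zero]
  rw [this]
  refine mul_le_mul_of_nonneg_left ?_ (by linarith)
  refine intervalIntegral.integral_mono_on hX ?_ hh.intervalIntegrable ?_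
  · exact Antitone.intervalIntegrable fun x y hxy => hh (by gcongr)
  · intro y hy
    exact hh (le_mul_of_one_le_left hy.1 hr)

theorem tendsto_integral_atTop (hI : ∫⁻ y in Set.Ioi (0 : ℝ), ENNReal.ofReal (h y) = ∞) :
    Tendsto (fun X : ℝ => ∫ y in (0)..X, h y) atTop atTop := by
  refine tendsto_atTop_atTop_of_monotone (fun X Y hXY => integral_mono_right hh hnn hXY) ?_
  by_contra! hcon
  obtain ⟨B, hB⟩ := hcon
  have := integrableOn_Ioi_of_intervalIntegral_norm_bounded (f := h) (μ := volume) B 0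
    (l := atTop) (b := fun x => x)
    (fun i => hh.intervalIntegrable.1) tendsto_id
    (Eventually.of_forall fun X => by
      refine le_trans (le_of_eq ?_) (hB X).le
      refine intervalIntegral.integral_congr fun y _ => Real.norm_of_nonneg (hnn y))
  exact this.lintegral_lt_top.ne hI

theorem exists_integral_le (hI : ∫⁻ y in Set.Ioi (0 : ℝ), ENNReal.ofReal (h y) < ∞) :
    ∃ B : ℝ, ∀ X : ℝ, 0 ≤ X → ∫ y in (0)..X, h y ≤ B := by
  have hint : IntegrableOn h (Set.Ioi 0) := by
    refine ⟨hh.measurable.aestronglyMeasurable, ?_⟩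
    rw [hasFiniteIntegral_iff_norm]
    simpa only [Real.norm_of_nonneg (hnn _)] using hI
  refine ⟨∫ y in Set.Ioi (0 : ℝ), h y, fun X hX => ?_⟩
  rw [intervalIntegral.integral_of_le hX]
  exact setIntegral_mono_set hint (Eventually.of_forall hnn)
    (Set.Ioc_subset_Ioi_self.eventuallyLE)

end Antitone

/-! ### Distances in weighted graphs -/

section Graph

variable {V : Type*} {G : SimpleGraph V} {len : Sym2 V → ℝ}

theorem lDist_le_walkLength {x y : V} (p : G.Walk x y) : lDist G len x y ≤ walkLength G len p := by
  classical
  refine (iInf_le _ p.toPath).trans ?_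
  exact List.Sublist.sum_le_sum (p.edges_bypass_sublist_edges.map _) fun _ _ => zero_le

theorem lDist_lt_top {x y : V} (h : G.Reachable x y) : lDist G len x y < ∞ := by
  obtain ⟨p⟩ := h
  refine (lDist_le_walkLength p).trans_lt ?_
  unfold walkLength
  generalize p.edges = l
  induction l with
  | nil => simp
  | cons e l ih => simpa [ENNReal.add_lt_top] using ih

theorem lDist_le_add_of_adj {x u v : V} (h : G.Adj u v) :
    lDist G len x v ≤ lDist G len x u + ENNReal.ofReal (len s(u, v)) := by
  conv_rhs => rw [lDist, ENNReal.iInf_add]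
  refine le_iInf fun p => (lDist_le_walkLength ((p : G.Walk x u).concat h)).trans ?_
  simp [walkLength, SimpleGraph.Walk.edges_concat, List.map_append, List.concat_eq_append]

/-- A path that gets to graph distance at least `n` passes through graph distance exactly `n`. -/
theorem hitSphere_le_lDist {x y : V} {n : ℕ} (h : (n : ℕ∞) ≤ G.edist x y) :
    hitSphere G len x n ≤ lDist G len x y := by
  classical
  refine le_iInf fun ⟨p, hp⟩ => ?_
  suffices H : ∀ (u v : V) (p : G.Walk u v), G.edist x u ≤ n → (n : ℕ∞) ≤ G.edist x v →
      ∃ (z : V) (q : G.Walk u z), G.edist x z = n ∧ walkLength G len q ≤ walkLength G len p by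
    obtain ⟨z, q, hz, hq⟩ := H x y p (by simp) h
    exact (iInf₂_le z hz).trans ((lDist_le_walkLength q).trans hq)
  intro u v p
  induction p with
  | nil =>
    intro h1 h2
    exact ⟨_, SimpleGraph.Walk.nil, le_antisymm h1 h2, le_rfl⟩
  | @cons u w v hadj p ih =>
    intro h1 h2
    rcases h1.lt_or_eq with h1 | h1
    · have : G.edist x w ≤ n := by
        refine (G.edist_triangle (v := u)).trans ?_
        rw [SimpleGraph.edist_eq_one_iff_adj.2 hadj]
        exact Order.add_one_le_of_lt h1
      obtain ⟨z, q, hz, hq⟩ := ih this h2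
      refine ⟨z, SimpleGraph.Walk.cons hadj q, hz, ?_⟩
      simp only [walkLength, SimpleGraph.Walk.edges_cons, List.map_cons, List.sum_cons] at hq ⊢
      gcongr
    · exact ⟨u, SimpleGraph.Walk.nil, h1, by simp [walkLength]⟩

theorem hitSphere_mono (x : V) : Monotone (hitSphere G len x) := fun m n hmn =>
  le_iInf₂ fun y hy => hitSphere_le_lDist (by
    rw [show G.edist x y = n from hy]; exact_mod_cast hmn)

theorem hitCount_mono (x : V) : Monotone (hitCount G len x) := fun _ _ hmn =>
  le_iInf₂ fun t ht => iInf₂_le t ((Nat.cast_le (α := ℕ∞).2 hmn).trans ht)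

/-- The graph distance is a potential: an edge from level `k - 1` to level `k` costs at least
`q k`, so that reaching level `n` costs at least `∑ k ≤ n, q k`. -/
theorem sum_le_hitSphere {x : V} {q : ℕ → ℝ≥0∞} (hG : G.Connected)
    (hq : ∀ u v, G.Adj u v → G.dist x v = G.dist x u + 1 →
      q (G.dist x v) ≤ ENNReal.ofReal (len s(u, v))) (n : ℕ) :
    ∑ k ∈ Finset.Icc 1 n, q k ≤ hitSphere G len x n := by
  have H : ∀ (u v : V) (p : G.Walk u v), ∑ k ∈ Finset.Icc 1 (G.dist x v), q k
      ≤ ∑ k ∈ Finset.Icc 1 (G.dist x u), q k + walkLength G len p := by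
    intro u v p
    induction p with
    | nil => exact le_self_add
    | @cons u w v hadj p ih =>
      have hstep : ∑ k ∈ Finset.Icc 1 (G.dist x w), q k
          ≤ ∑ k ∈ Finset.Icc 1 (G.dist x u), q k + ENNReal.ofReal (len s(u, w)) := by
        have htri : G.dist x w ≤ G.dist x u + 1 := by
          refine (hG.dist_triangle (v := u)).trans ?_
          rw [SimpleGraph.dist_eq_one_iff_adj.2 hadj]
        rcases Nat.lt_or_eq_of_le htri with hlt | heq
        · refine le_add_right (Finset.sum_le_sum_of_subset ?_)
          exact Finset.Icc_subset_Icc_right (by omega)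
        · have h1 := hq u w hadj heq
          rw [heq] at h1 ⊢
          rw [Finset.sum_Icc_succ_top (by omega)]
          gcongr
      refine ih.trans ((add_le_add_left hstep _).trans (le_of_eq ?_))
      simp only [walkLength, SimpleGraph.Walk.edges_cons, List.map_cons, List.sum_cons]
      ring
  refine le_iInf₂ fun y hy => le_iInf fun ⟨p, _⟩ => ?_
  have hd : G.dist x y = n := by
    rw [SimpleGraph.dist, show G.edist x y = n from hy]; rfl
  simpa [hd] using H x y p

theorem finite_setOf_dist_le (hG : G.Connected) (hfin : ∀ u, (G.neighborSet u).Finite) (x : V)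
    (n : ℕ) : {y | G.dist x y ≤ n}.Finite := by
  induction n with
  | zero =>
    refine (Set.finite_singleton x).subset fun y hy => ?_
    have := hG.dist_eq_zero_iff.1 (Nat.le_zero.1 hy)
    exact this.symm
  | succ n ih =>
    refine (ih.union (ih.biUnion fun u _ => hfin u)).subset fun y hy => ?_
    rcases Nat.lt_or_eq_of_le (show G.dist x y ≤ n + 1 from hy) with h | h
    · exact Or.inl (Nat.le_of_lt_succ h)
    · obtain ⟨p, hp⟩ := hG.exists_walk_length_eq_dist x y
      refine Or.inr (Set.mem_biUnion (x := p.getVert n) ?_ ?_)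
      · refine (SimpleGraph.dist_le (p.take n)).trans ?_
        simp
      · have := p.adj_getVert_succ (i := n) (by omega)
        rwa [p.getVert_of_length_le (i := n + 1) (by omega)] at this

/-- In a connected locally finite graph, infinitely many vertices are reached before time `t`
exactly if every graph distance is. -/
theorem iSup_hitCount_eq_iSup_hitSphere (hG : G.Connected)
    (hfin : ∀ u, (G.neighborSet u).Finite) (x : V) :
    ⨆ n, hitCount G len x n = ⨆ n, hitSphere G len x n := by
  refine le_antisymm (iSup_le fun n => ?_) (iSup_le fun n => ?_)
  · -- a vertex at distance `n` comes with the `n + 1` vertices of a path to it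
    refine ENNReal.le_of_forall_pos_le_add fun ε hε hlt => ?_
    set T := ⨆ n, hitSphere G len x n
    have hlt' : hitSphere G len x n < T + ε :=
      (le_iSup (hitSphere G len x) n).trans_lt (ENNReal.lt_add_right hlt.ne (by simpa using hε.ne'))
    obtain ⟨y, hy, hyl⟩ : ∃ y, G.edist x y = n ∧ lDist G len x y < T + ε := by
      simpa [hitSphere, iInf_lt_iff, graphSphere] using hlt'
    obtain ⟨⟨p, hp⟩, hpl⟩ := iInf_lt_iff.1 hyl
    have hplen : n ≤ p.length := by
      have := p.edist_le
      rw [hy] at this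
      exact_mod_cast this
    set t : ℝ≥0 := (T + ε).toNNReal
    have ht : (t : ℝ≥0∞) = T + ε :=
      ENNReal.coe_toNNReal (ENNReal.add_lt_top.2 ⟨hlt, ENNReal.coe_lt_top⟩).ne
    rw [← ht]
    refine iInf₂_le t ?_
    have hinj : Set.InjOn p.getVert (Set.Iic n) := fun i hi j hj hij =>
      hp.getVert_injOn (le_trans hi hplen) (le_trans hj hplen) hij
    have hsub : p.getVert '' (Set.Iic n) ⊆ lBall G len x t := by
      rintro _ ⟨i, hi, rfl⟩
      show lDist G len x _ ≤ t
      rw [ht]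
      refine le_trans ?_ hpl.le
      refine (lDist_le_walkLength (p.take i)).trans ?_
      refine List.Sublist.sum_le_sum (List.Sublist.map _ ?_) fun _ _ => zero_le
      rw [p.edges_take]
      exact List.take_sublist _ _
    refine le_trans ?_ (Set.encard_le_encard hsub)
    rw [hinj.encard_image]
    have : (Set.Iic n).encard = ((n + 1 : ℕ) : ℕ∞) := by
      rw [← Finset.coe_Iic, Set.encard_coe_eq_coe_finsetCard, Nat.card_Iic]
    rw [this]
    exact_mod_cast Nat.le_succ n
  · -- a finite ball of the graph distance cannot contain arbitrarily many vertices
    set T := ⨆ n, hitCount G len x n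
    refine ENNReal.le_of_forall_pos_le_add fun ε hε hlt => ?_
    have hF := finite_setOf_dist_le hG hfin x n
    have hlt' : hitCount G len x (hF.toFinset.card + 1) < T + ε :=
      (le_iSup (hitCount G len x) _).trans_lt
        (ENNReal.lt_add_right hlt.ne (by simpa using hε.ne'))
    obtain ⟨t, ht, htl⟩ : ∃ t : ℝ≥0, ((hF.toFinset.card + 1 : ℕ) : ℕ∞) ≤ (lBall G len x t).encard
        ∧ (t : ℝ≥0∞) < T + ε := by
      simpa only [hitCount, iInf_lt_iff, exists_prop] using hlt'
    obtain ⟨y, hy, hyn⟩ : ∃ y ∈ lBall G len x t, ¬ G.dist x y ≤ n := by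
      by_contra! hcon
      have h1 := Set.encard_le_encard (s := lBall G len x t) (t := hF.toFinset)
        (fun y hy => by simpa using hcon y hy)
      rw [Set.encard_coe_eq_coe_finsetCard] at h1
      have := ht.trans h1
      norm_cast at this
      omega
    refine (hitSphere_le_lDist ?_).trans ((show lDist G len x y ≤ t from hy).trans htl.le)
    rw [(hG.preconnected x y).coe_dist_eq_edist.symm]
    exact_mod_cast (not_le.1 hyn).le

/-- The hitting time of size `n` as an infimum over the countably many finite sets of vertices;
this makes its measurability visible. -/
theorem hitCount_eq_iInf_finset (x : V) (n : ℕ) :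
    hitCount G len x n = ⨅ (s : Finset V) (_ : s.card = n), s.sup (lDist G len x) := by
  refine le_antisymm (le_iInf₂ fun s hs => ?_) (le_iInf₂ fun t ht => ?_)
  · rcases eq_or_ne (s.sup (lDist G len x)) ∞ with h | h
    · rw [h]; exact le_top
    · refine (iInf₂_le (s.sup (lDist G len x)).toNNReal ?_).trans (ENNReal.coe_toNNReal h).le
      rw [← hs, ← Set.encard_coe_eq_coe_finsetCard]
      refine Set.encard_le_encard fun y hy => ?_
      show lDist G len x y ≤ _
      rw [ENNReal.coe_toNNReal h]
      exact Finset.le_sup (f := lDist G len x) hy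
  · obtain ⟨s, hs, hsn⟩ := Set.exists_subset_encard_eq ht
    have hfin : s.Finite := Set.finite_of_encard_eq_coe hsn
    refine (iInf₂_le hfin.toFinset ?_).trans (Finset.sup_le fun y hy => hs (by simpa using hy))
    rw [hfin.encard_eq_coe_toFinset_card] at hsn
    exact_mod_cast hsn

/-- The `L`-distance as an infimum over the walks of the complete graph, which do not depend on
`G`. -/
theorem lDist_eq_iInf_top_walk (x y : V) :
    lDist G len x y = ⨅ p : (⊤ : SimpleGraph V).Walk x y,
      ⨅ _ : ∀ e ∈ p.edges, e ∈ G.edgeSet, (p.edges.map fun e => ENNReal.ofReal (len e)).sum := by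
  refine le_antisymm (le_iInf₂ fun p hp => ?_) (le_iInf fun ⟨p, _⟩ => ?_)
  · refine (lDist_le_walkLength (p.transfer G hp)).trans ?_
    rw [walkLength, SimpleGraph.Walk.edges_transfer]
  · have h : ∀ e ∈ p.edges, e ∈ (⊤ : SimpleGraph V).edgeSet := fun e he =>
      SimpleGraph.edgeSet_mono le_top (p.edges_subset_edgeSet he)
    refine (iInf₂_le (p.transfer ⊤ h) ?_).trans ?_
    · rw [SimpleGraph.Walk.edges_transfer]
      exact fun e he => p.edges_subset_edgeSet he
    · rw [SimpleGraph.Walk.edges_transfer]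
      rfl

end Graph

theorem measurable_hitCount {V Ω : Type*} [Countable V] [MeasurableSpace Ω]
    {G : Ω → SimpleGraph V} {L : Sym2 V → Ω → ℝ}
    (hG : ∀ e, MeasurableSet {ω | e ∈ (G ω).edgeSet}) (hL : ∀ e, Measurable (L e)) (x : V)
    (n : ℕ) : Measurable fun ω => hitCount (G ω) (fun e => L e ω) x n := by
  have hd : ∀ y, Measurable fun ω => lDist (G ω) (fun e => L e ω) x y := by
    intro y
    simp only [lDist_eq_iInf_top_walk]
    have : Countable ((⊤ : SimpleGraph V).Walk x y) :=
      Function.Injective.countable (f := fun p => p.support) fun p q h =>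
        SimpleGraph.Walk.ext_support h
    refine Measurable.iInf fun p => ?_
    have hs : MeasurableSet {ω | ∀ e ∈ p.edges, e ∈ (G ω).edgeSet} := by
      have := MeasurableSet.biInter (s := {e | e ∈ p.edges}) (List.finite_toSet _).countable
        fun e _ => hG e
      convert this using 1
      ext ω
      simp
    have hm : Measurable fun ω => (p.edges.map fun e => ENNReal.ofReal (L e ω)).sum := by
      generalize p.edges = l
      induction l with
      | nil => simp
      | cons e l ih =>
        simp only [List.map_cons, List.sum_cons]
        exact (hL e).ennreal_ofReal.add ih
    classical
    have : Measurable fun ω => if ∀ e ∈ p.edges, e ∈ (G ω).edgeSet then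
        (p.edges.map fun e => ENNReal.ofReal (L e ω)).sum else ∞ :=
      Measurable.ite hs hm measurable_const
    convert this using 1
    funext ω
    by_cases hp : ∀ e ∈ p.edges, e ∈ (G ω).edgeSet
    · rw [if_pos hp, iInf_pos hp]
    · rw [if_neg hp, iInf_neg hp]
  simp only [hitCount_eq_iInf_finset]
  refine Measurable.iInf fun s => Measurable.iInf_Prop _ ?_
  induction s using Finset.cons_induction with
  | empty => simp
  | cons y s hy ih =>
    simp only [Finset.sup_cons]
    exact (hd y).sup ih

/-! ### Finite-dimensional laws of the percolation -/

theorem latticeDist_nonneg {d : ℕ} (x y : Fin d → ℤ) : 0 ≤ latticeDist x y := norm_nonneg _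

theorem connProb_mk {d : ℕ} (lam α : ℝ) (w : (Fin d → ℤ) → ℝ) (x y : Fin d → ℤ) :
    connProb lam α w s(x, y) = if latticeDist x y = 1 then 1
      else 1 - Real.exp (-(lam * (w x * w y) / latticeDist x y ^ α)) := rfl

theorem connProb_mem_Icc {d : ℕ} {lam α : ℝ} (hlam : 0 ≤ lam) {w : (Fin d → ℤ) → ℝ}
    (hw : ∀ x, 0 ≤ w x) (e : Sym2 (Fin d → ℤ)) : connProb lam α w e ∈ Set.Icc 0 1 := by
  induction e using Sym2.ind with
  | _ x y =>
    rw [connProb_mk]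
    split_ifs
    · simp
    · have h0 : 0 ≤ lam * (w x * w y) / latticeDist x y ^ α :=
        div_nonneg (mul_nonneg hlam (mul_nonneg (hw x) (hw y)))
          (Real.rpow_nonneg (latticeDist_nonneg x y) _)
      exact ⟨by simpa using h0,
        by linarith [Real.exp_pos (-(lam * (w x * w y) / latticeDist x y ^ α))]⟩

theorem measurable_connProb {d : ℕ} {Ω : Type*} {m : MeasurableSpace Ω}
    {W : (Fin d → ℤ) → Ω → ℝ} (hW : ∀ x, Measurable (W x)) (lam α : ℝ) (e : Sym2 (Fin d → ℤ)) :
    Measurable fun ω => connProb lam α (fun x => W x ω) e := by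
  induction e using Sym2.ind with
  | _ x y =>
    simp only [connProb_mk]
    split_ifs
    · exact measurable_const
    · have := hW x
      have := hW y
      fun_prop

namespace IsWeightedScaleFreePercolation

variable {d : ℕ} {Ω : Type*} [MeasurableSpace Ω] {μ : Measure Ω}
  {lam α : ℝ} {PW PL : Measure ℝ} {W : (Fin d → ℤ) → Ω → ℝ}
  {G : Ω → SimpleGraph (Fin d → ℤ)} {L : Sym2 (Fin d → ℤ) → Ω → ℝ}

theorem weightSigma_le (h : IsWeightedScaleFreePercolation μ lam α PW PL W G L) :
    weightSigma W ≤ (inferInstance : MeasurableSpace Ω) :=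
  (measurable_pi_lambda _ h.measurable_weight).comap_le

theorem ae_weight (h : IsWeightedScaleFreePercolation μ lam α PW PL W G L)
    (hW1 : ∀ᵐ w ∂PW, 1 ≤ w) : ∀ᵐ ω ∂μ, ∀ x, 1 ≤ W x ω := by
  refine ae_all_iff.2 fun x => ?_
  have := h.law_weight x ▸ hW1
  exact ae_of_ae_map (h.measurable_weight x).aemeasurable this

/-- The probability that all edges of a finite set are present with prescribed lengths, on an event
that depends on the vertex-weights only. -/
theorem measureReal_forall_edge [IsProbabilityMeasure μ]
    (h : IsWeightedScaleFreePercolation μ lam α PW PL W G L)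
    {T : Finset (Sym2 (Fin d → ℤ))} (hT : ∀ e ∈ T, ¬ e.IsDiag) {A : Set Ω}
    (hA : MeasurableSet[weightSigma W] A) {B : Sym2 (Fin d → ℤ) → Set ℝ}
    (hB : ∀ e, MeasurableSet (B e)) :
    μ.real (A ∩ {ω | ∀ e ∈ T, e ∈ (G ω).edgeSet ∧ L e ω ∈ B e})
      = ∫ ω in A, ∏ e ∈ T, (connProb lam α (fun x => W x ω) e * PL.real (B e)) ∂μ := by
  have hm := h.weightSigma_le
  set E : Set Ω := {ω | ∀ e ∈ T, e ∈ (G ω).edgeSet}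
  have hE : MeasurableSet E := by
    have : E = ⋂ e ∈ T, {ω | e ∈ (G ω).edgeSet} := by ext; simp [E]
    rw [this]
    exact T.measurableSet_biInter fun e _ => h.measurableSet_edge e
  have hsplit : A ∩ {ω | ∀ e ∈ T, e ∈ (G ω).edgeSet ∧ L e ω ∈ B e}
      = (⋂ e ∈ T, L e ⁻¹' B e) ∩ (A ∩ E) := by
    ext ω
    simp only [Set.mem_inter_iff, Set.mem_iInter, Set.mem_preimage, E, Set.mem_ofPred_eq]
    constructor
    · exact fun ⟨hA, hT⟩ => ⟨fun e he => (hT e he).2, hA, fun e he => (hT e he).1⟩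
    · exact fun ⟨hL, hA, hE⟩ => ⟨hA, fun e he => ⟨hE e he, hL e he⟩⟩
  have hind : μ.real ((⋂ e ∈ T, L e ⁻¹' B e) ∩ (A ∩ E))
      = μ.real (⋂ e ∈ T, L e ⁻¹' B e) * μ.real (A ∩ E) := by
    obtain ⟨A', hA', rfl⟩ := hA
    have h1 : (⋂ e ∈ T, L e ⁻¹' B e)
        = (fun ω e => L e ω) ⁻¹' (⋂ e ∈ T, (fun l : Sym2 (Fin d → ℤ) → ℝ => l e) ⁻¹' B e) := by
      ext; simp
    have h2 : (fun ω x => W x ω) ⁻¹' A' ∩ E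
        = (fun ω => ((fun x => W x ω : (Fin d → ℤ) → ℝ),
          (fun e => e ∈ (G ω).edgeSet : Sym2 (Fin d → ℤ) → Prop))) ⁻¹'
            (A' ×ˢ (⋂ e ∈ T, (fun g : Sym2 (Fin d → ℤ) → Prop => g e) ⁻¹' {True})) := by
      ext; simp [E]
    rw [h1, h2, measureReal_def, h.indep_length_graph.measure_inter_preimage_eq_mul,
      ENNReal.toReal_mul]
    · rfl
    · exact T.measurableSet_biInter fun e _ => measurable_pi_apply e (hB e)
    · exact hA'.prod (T.measurableSet_biInter fun e _ => measurable_pi_apply e trivial)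
  have hL : μ.real (⋂ e ∈ T, L e ⁻¹' B e) = ∏ e ∈ T, PL.real (B e) := by
    rw [measureReal_def, h.indep_length.measure_inter_preimage_eq_mul T fun e _ => hB e,
      ENNReal.toReal_prod]
    refine Finset.prod_congr rfl fun e _ => ?_
    rw [← h.law_length e, measureReal_def, Measure.map_apply (h.measurable_length e) (hB e)]
  have hW : μ.real (A ∩ E) = ∫ ω in A, ∏ e ∈ T, connProb lam α (fun x => W x ω) e ∂μ := by
    rw [← setIntegral_congr_ae (hm _ hA) ((h.cond_edge T hT).mono fun ω hω _ => hω),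
      setIntegral_condExp hm ((integrable_const (1 : ℝ)).indicator hE) hA,
      setIntegral_indicator hE]
    simp
  rw [hsplit, hind, hL, hW, ← integral_const_mul]
  simp_rw [Finset.prod_mul_distrib, mul_comm]

/-- The probability that no edge `e` of a finite set is present with a length in `B` while the
event `D e` occurs, on an event `A`, where `A` and `D e` depend on the vertex-weights only. -/
theorem measureReal_forall_not_edge [IsProbabilityMeasure μ]
    (h : IsWeightedScaleFreePercolation μ lam α PW PL W G L)
    [IsProbabilityMeasure PL] (hlam : 0 ≤ lam) (hW1 : ∀ᵐ w ∂PW, 1 ≤ w)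
    {T : Finset (Sym2 (Fin d → ℤ))} (hT : ∀ e ∈ T, ¬ e.IsDiag) {A : Set Ω}
    (hA : MeasurableSet[weightSigma W] A) {D : Sym2 (Fin d → ℤ) → Set Ω}
    (hD : ∀ e, MeasurableSet[weightSigma W] (D e)) {B : Set ℝ} (hB : MeasurableSet B) :
    μ.real (A ∩ {ω | ∀ e ∈ T, ¬ (ω ∈ D e ∧ e ∈ (G ω).edgeSet ∧ L e ω ∈ B)})
      = ∫ ω in A, ∏ e ∈ T, (1 - (D e).indicator
          (fun ω => connProb lam α (fun x => W x ω) e * PL.real B) ω) ∂μ := by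
  classical
  have hm := h.weightSigma_le
  set f : Sym2 (Fin d → ℤ) → Ω → ℝ := fun e =>
    (D e).indicator fun ω => connProb lam α (fun x => W x ω) e * PL.real B with hfdef
  have hfm : ∀ e, Measurable (f e) := fun e =>
    ((measurable_connProb h.measurable_weight lam α e).mul_const _).indicator (hm _ (hD e))
  have hf01 : ∀ᵐ ω ∂μ, ∀ e, f e ω ∈ Set.Icc 0 1 := by
    filter_upwards [h.ae_weight hW1] with ω hω e
    have h1 := connProb_mem_Icc (α := α) hlam (fun x => zero_le_one.trans (hω x)) e
    simp only [hfdef, Set.indicator_apply]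
    split_ifs
    · exact ⟨mul_nonneg h1.1 measureReal_nonneg,
        mul_le_one₀ h1.2 measureReal_nonneg measureReal_le_one⟩
    · simp
  have hint : ∀ T₁ T₂ : Finset (Sym2 (Fin d → ℤ)),
      Integrable (fun ω => (∏ e ∈ T₁, f e ω) * ∏ e ∈ T₂, (1 - f e ω)) (μ.restrict A) := by
    intro T₁ T₂
    refine Integrable.of_bound (C := 1) (Measurable.aestronglyMeasurable ?_)
      (ae_restrict_of_ae (hf01.mono fun ω hω => ?_))
    · exact (Finset.measurable_prod _ fun e _ => hfm e).mul
        (Finset.measurable_prod _ fun e _ => (hfm e).const_sub 1)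
    · have h1 : 0 ≤ ∏ e ∈ T₁, f e ω := Finset.prod_nonneg fun e _ => (hω e).1
      have h2 : 0 ≤ ∏ e ∈ T₂, (1 - f e ω) :=
        Finset.prod_nonneg fun e _ => sub_nonneg.2 (hω e).2
      rw [Real.norm_of_nonneg (mul_nonneg h1 h2)]
      exact mul_le_one₀ (Finset.prod_le_one (fun e _ => (hω e).1) fun e _ => (hω e).2) h2
        (Finset.prod_le_one (fun e _ => sub_nonneg.2 (hω e).2) fun e _ => by linarith [(hω e).1])
  -- inclusion-exclusion, one edge at a time
  suffices H : ∀ T₂ T₁ : Finset (Sym2 (Fin d → ℤ)), Disjoint T₁ T₂ →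
      (∀ e ∈ T₁, ¬ e.IsDiag) → (∀ e ∈ T₂, ¬ e.IsDiag) →
      μ.real ((A ∩ {ω | ∀ e ∈ T₁, ω ∈ D e ∧ e ∈ (G ω).edgeSet ∧ L e ω ∈ B})
        ∩ {ω | ∀ e ∈ T₂, ¬ (ω ∈ D e ∧ e ∈ (G ω).edgeSet ∧ L e ω ∈ B)})
      = ∫ ω in A, (∏ e ∈ T₁, f e ω) * ∏ e ∈ T₂, (1 - f e ω) ∂μ by
    simpa using H T ∅ (Finset.disjoint_empty_left _) (by simp) hT
  intro T₂
  induction T₂ using Finset.induction_on with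
  | empty =>
    intro T₁ _ h1 _
    have hD' : MeasurableSet[weightSigma W] (⋂ e ∈ T₁, D e) :=
      T₁.measurableSet_biInter fun e _ => hD e
    have hset : A ∩ {ω | ∀ e ∈ T₁, ω ∈ D e ∧ e ∈ (G ω).edgeSet ∧ L e ω ∈ B}
        = (A ∩ ⋂ e ∈ T₁, D e) ∩ {ω | ∀ e ∈ T₁, e ∈ (G ω).edgeSet ∧ L e ω ∈ B} := by
      ext ω
      simp only [Set.mem_inter_iff, Set.mem_ofPred_eq, Set.mem_iInter, and_assoc]
      refine and_congr_right fun _ => ?_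
      exact ⟨fun H => ⟨fun e he => (H e he).1, fun e he => (H e he).2⟩,
        fun H e he => ⟨H.1 e he, H.2 e he⟩⟩
    simp only [Finset.notMem_empty, false_imp_iff, implies_true, Set.ofPred_true, Set.inter_univ,
      Finset.prod_empty, mul_one]
    rw [hset, h.measureReal_forall_edge h1 (MeasurableSet.inter hA hD') (fun _ => hB),
      ← setIntegral_indicator (hm _ hD')]
    refine integral_congr_ae (Eventually.of_forall fun ω => ?_)
    simp only [hfdef]
    by_cases hω : ω ∈ ⋂ e ∈ T₁, D e
    · rw [Set.indicator_of_mem hω]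
      refine Finset.prod_congr rfl fun e he => ?_
      rw [Set.indicator_of_mem (Set.mem_iInter₂.1 hω e he)]
    · rw [Set.indicator_of_notMem hω]
      simp only [Set.mem_iInter, not_forall] at hω
      obtain ⟨e, he, hωe⟩ := hω
      exact (Finset.prod_eq_zero he (Set.indicator_of_notMem hωe _)).symm
  | insert e T₂ he ih =>
    intro T₁ hdis h1 h2
    rw [Finset.disjoint_insert_right] at hdis
    have ih1 := ih T₁ hdis.2 h1 fun e he => h2 e (Finset.mem_insert_of_mem he)
    have ih2 := ih (insert e T₁) (Finset.disjoint_insert_left.2 ⟨he, hdis.2⟩)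
      (fun e' he' => (Finset.mem_insert.1 he').elim
        (fun h => h ▸ h2 e (Finset.mem_insert_self _ _)) (h1 e'))
      fun e he => h2 e (Finset.mem_insert_of_mem he)
    set X : Set Ω := (A ∩ {ω | ∀ e ∈ T₁, ω ∈ D e ∧ e ∈ (G ω).edgeSet ∧ L e ω ∈ B})
        ∩ {ω | ∀ e ∈ T₂, ¬ (ω ∈ D e ∧ e ∈ (G ω).edgeSet ∧ L e ω ∈ B)}
    have hgood : MeasurableSet {ω | ω ∈ D e ∧ e ∈ (G ω).edgeSet ∧ L e ω ∈ B} :=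
      (hm _ (hD e)).inter ((h.measurableSet_edge e).inter (h.measurable_length e hB))
    have e1 : (A ∩ {ω | ∀ e' ∈ T₁, ω ∈ D e' ∧ e' ∈ (G ω).edgeSet ∧ L e' ω ∈ B})
        ∩ {ω | ∀ e' ∈ insert e T₂, ¬ (ω ∈ D e' ∧ e' ∈ (G ω).edgeSet ∧ L e' ω ∈ B)}
        = X \ {ω | ω ∈ D e ∧ e ∈ (G ω).edgeSet ∧ L e ω ∈ B} := by
      ext ω
      simp only [X, Set.mem_inter_iff, Set.mem_ofPred_eq, Set.mem_sdiff, Finset.forall_mem_insert]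
      tauto
    have e2 : (A ∩ {ω | ∀ e' ∈ insert e T₁, ω ∈ D e' ∧ e' ∈ (G ω).edgeSet ∧ L e' ω ∈ B})
        ∩ {ω | ∀ e' ∈ T₂, ¬ (ω ∈ D e' ∧ e' ∈ (G ω).edgeSet ∧ L e' ω ∈ B)}
        = X ∩ {ω | ω ∈ D e ∧ e ∈ (G ω).edgeSet ∧ L e ω ∈ B} := by
      ext ω
      simp only [X, Set.mem_inter_iff, Set.mem_ofPred_eq, Finset.forall_mem_insert]
      tauto
    have hadd := measureReal_inter_add_sdiff (μ := μ) (s := X) hgood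
    rw [e2] at ih2
    rw [e1, eq_sub_of_add_eq' hadd, ih1, ih2, ← integral_sub (hint _ _) (hint _ _)]
    refine integral_congr_ae (Eventually.of_forall fun ω => ?_)
    simp only [Finset.prod_insert he, Finset.prod_insert hdis.1]
    ring

/-- The nearest-neighbour edges are present, whence the graph is connected. -/
theorem ae_connected [IsProbabilityMeasure μ]
    (h : IsWeightedScaleFreePercolation μ lam α PW PL W G L)
    [IsProbabilityMeasure PL] : ∀ᵐ ω ∂μ, (G ω).Connected := by
  have hnn : ∀ᵐ ω ∂μ, ∀ x y : Fin d → ℤ, latticeDist x y = 1 → (G ω).Adj x y := by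
    refine ae_all_iff.2 fun x => ae_all_iff.2 fun y => ?_
    by_cases hxy : latticeDist x y = 1
    · have hne : ¬ s(x, y).IsDiag := by
        rw [Sym2.mk_isDiag_iff]
        rintro rfl
        simp [latticeDist] at hxy
        have : (WithLp.toLp 2 fun _ => 0 : EuclideanSpace ℝ (Fin d)) = 0 := rfl
        simp [this] at hxy
      have := h.measureReal_forall_edge (T := {s(x, y)}) (A := Set.univ) (B := fun _ => Set.univ)
        (by simpa using hne) MeasurableSet.univ (fun _ => MeasurableSet.univ)
      have hset : {ω | (G ω).Adj x y}ᶜ = {ω | s(x, y) ∈ (G ω).edgeSet}ᶜ := rfl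
      simp only [Set.univ_inter, Finset.mem_singleton, forall_eq, Finset.prod_singleton,
        connProb_mk, hxy, if_true, Set.mem_univ, and_true] at this
      simp only [probReal_univ, mul_one, integral_const, smul_eq_mul,
        Measure.restrict_univ] at this
      have h0 := probReal_compl_eq_one_sub (μ := μ) (h.measurableSet_edge s(x, y))
      rw [this, sub_self] at h0
      have h1 : μ {ω | (G ω).Adj x y}ᶜ = 0 := by
        rw [hset]
        exact (measureReal_eq_zero_iff).1 h0
      filter_upwards [measure_eq_zero_iff_ae_notMem.1 h1] with ω hω _
      simpa using hω
    · exact Eventually.of_forall fun ω hc => absurd hc hxy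
  filter_upwards [hnn] with ω hω
  have hstep : ∀ (y : Fin d → ℤ) (i : Fin d), (G ω).Reachable y (y + Pi.single i 1) := by
    intro y i
    refine (hω _ _ ?_).reachable
    rw [latticeDist, ← norm_neg]
    have : -(WithLp.toLp 2 fun j => ((y j : ℝ) - ((y + Pi.single i 1 : Fin d → ℤ) j : ℝ)) :
        EuclideanSpace ℝ (Fin d)) = EuclideanSpace.single i 1 := by
      ext j
      by_cases hij : j = i
      · subst hij; simp
      · simp [hij]
    rw [this]
    simp
  have hline : ∀ (n : ℤ) (y : Fin d → ℤ) (i : Fin d),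
      (G ω).Reachable y (y + Pi.single i n) := by
    intro n y i
    induction n using Int.induction_on with
    | zero => simp
    | succ n ih =>
      rw [Pi.single_add, ← add_assoc]
      exact ih.trans (hstep _ i)
    | pred n ih =>
      refine ih.trans ?_
      have := (hstep (y + Pi.single i (-(n : ℤ) - 1)) i).symm
      rwa [add_assoc, ← Pi.single_add, sub_add_cancel] at this
  have hall : ∀ (s : Finset (Fin d)) (z y : Fin d → ℤ),
      (G ω).Reachable y (y + ∑ i ∈ s, Pi.single i (z i)) := by
    intro s z y
    induction s using Finset.induction_on with
    | empty => simp
    | insert i s hi ih =>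
      rw [Finset.sum_insert hi, add_comm (Pi.single (M := fun _ => ℤ) i (z i)), ← add_assoc]
      exact ih.trans (hline _ _ _)
  refine ⟨fun x y => ?_⟩
  have := hall Finset.univ (y - x) x
  rwa [Finset.univ_sum_single, add_sub_cancel] at this

end IsWeightedScaleFreePercolation

/-! ### Lattice paths with truncated weights -/

/-- A summable kernel on `ℤ^d` (for `r > 1`) that factorises over the coordinates and dominates
`‖z‖ ^ (-d r)`. -/
noncomputable def latticeKernel {d : ℕ} (r : ℝ) (z : Fin d → ℤ) : ℝ :=
  ∏ i, (1 + |(z i : ℝ)|) ^ (-r)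

theorem latticeKernel_pos {d : ℕ} (r : ℝ) (z : Fin d → ℤ) : 0 < latticeKernel r z :=
  Finset.prod_pos fun _ _ => by positivity

theorem tsum_fin_pi_prod {X : Type*} (f : X → ℝ≥0∞) (k : ℕ) :
    ∑' v : Fin k → X, ∏ i, f (v i) = (∑' z, f z) ^ k := by
  induction k with
  | zero => simp
  | succ k ih =>
    rw [← (Fin.consEquiv fun _ => X).tsum_eq, ENNReal.tsum_prod', pow_succ', ← ih,
      ← ENNReal.tsum_mul_right]
    refine tsum_congr fun z => ?_
    rw [← ENNReal.tsum_mul_left]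
    refine tsum_congr fun v => ?_
    simp [Fin.prod_univ_succ]

theorem tsum_latticeKernel_lt_top (d : ℕ) {r : ℝ} (hr : 1 < r) :
    ∑' z : Fin d → ℤ, ENNReal.ofReal (latticeKernel r z) < ∞ := by
  have h1 : Summable fun n : ℤ => (1 + |(n : ℝ)|) ^ (-r) := by
    have hnat : Summable fun n : ℕ => (1 + (n : ℝ)) ^ (-r) := by
      have := (summable_nat_add_iff 1).2 (Real.summable_nat_rpow.2 (neg_lt_neg hr))
      refine this.congr fun n => ?_
      push_cast
      rw [add_comm]
    refine Summable.of_nat_of_neg ?_ ?_ <;> simpa using hnat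
  have h2 : ∀ z : Fin d → ℤ, ENNReal.ofReal (latticeKernel r z)
      = ∏ i, ENNReal.ofReal ((1 + |(z i : ℝ)|) ^ (-r)) := fun z =>
    ENNReal.ofReal_prod_of_nonneg fun _ _ => by positivity
  simp_rw [h2]
  rw [tsum_fin_pi_prod (fun n : ℤ => ENNReal.ofReal ((1 + |(n : ℝ)|) ^ (-r)))]
  exact ENNReal.pow_lt_top h1.tsum_ofReal_lt_top

/-- The sum over all lattice paths with `k` steps from `x` of a product over the steps. -/
theorem tsum_path_prod {d : ℕ} (f : (Fin d → ℤ) → ℝ≥0∞) (k : ℕ) (x : Fin d → ℤ) :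
    ∑' v : Fin k → Fin d → ℤ,
      ∏ i, f (v i - (Fin.cons x v : Fin (k + 1) → Fin d → ℤ) i.castSucc) = (∑' z, f z) ^ k := by
  induction k generalizing x with
  | zero => simp
  | succ k ih =>
    rw [← (Fin.consEquiv fun _ => Fin d → ℤ).tsum_eq, ENNReal.tsum_prod', pow_succ']
    have : ∑' z, f z = ∑' y, f (y - x) := ((Equiv.subRight x).tsum_eq f).symm
    rw [this, ← ENNReal.tsum_mul_right, ← this]
    refine tsum_congr fun y => ?_
    rw [← ih y, ← ENNReal.tsum_mul_left]
    refine tsum_congr fun v => ?_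
    simp [Fin.prod_univ_succ, Fin.castSucc_succ]

theorem abs_sub_le_latticeDist {d : ℕ} (x y : Fin d → ℤ) (i : Fin d) :
    |((y i - x i : ℤ) : ℝ)| ≤ latticeDist x y := by
  have := PiLp.norm_apply_le (p := 2)
    (WithLp.toLp 2 fun i => ((x i : ℝ) - (y i : ℝ)) : EuclideanSpace ℝ (Fin d)) i
  rw [Int.cast_sub, abs_sub_comm]
  simpa [latticeDist] using this

theorem one_le_latticeDist {d : ℕ} {x y : Fin d → ℤ} (hxy : x ≠ y) : 1 ≤ latticeDist x y := by
  obtain ⟨i, hi⟩ := Function.ne_iff.1 hxy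
  refine le_trans ?_ (abs_sub_le_latticeDist x y i)
  rw [← Int.cast_abs]
  exact_mod_cast Int.one_le_abs (sub_ne_zero.2 hi.symm)

theorem latticeDist_rpow_neg_le {d : ℕ} {x y : Fin d → ℤ} (hxy : x ≠ y) {r : ℝ} (hr : 0 ≤ r) :
    latticeDist x y ^ (-(d * r)) ≤ 2 ^ (d * r) * latticeKernel r (y - x) := by
  have h1 := one_le_latticeDist hxy
  have h0 : 0 < latticeDist x y := by linarith
  have : (2 * latticeDist x y) ^ (-(d * r)) ≤ latticeKernel r (y - x) := by
    have e : (2 * latticeDist x y) ^ (-(d * r)) = ∏ _i : Fin d, (2 * latticeDist x y) ^ (-r) := by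
      rw [Finset.prod_const, Finset.card_univ, Fintype.card_fin, ← Real.rpow_mul_natCast
        (by positivity)]
      congr 1; ring
    rw [e]
    refine Finset.prod_le_prod (fun _ _ => by positivity) fun i _ => ?_
    refine Real.rpow_le_rpow_of_nonpos (by positivity) ?_ (by linarith)
    have := abs_sub_le_latticeDist x y i
    simp only [Pi.sub_apply]
    linarith
  rw [Real.mul_rpow two_pos.le h0.le, Real.rpow_neg two_pos.le] at this
  rwa [inv_mul_le_iff₀ (by positivity)] at this

theorem one_sub_exp_neg_le_rpow {t s : ℝ} (ht : 0 ≤ t) (hs0 : 0 ≤ s) (hs1 : s ≤ 1) :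
    1 - Real.exp (-t) ≤ t ^ s := by
  rcases le_total t 1 with h | h
  · rcases ht.eq_or_lt with rfl | ht
    · simpa using Real.rpow_nonneg le_rfl s
    · calc 1 - Real.exp (-t) ≤ t := by linarith [Real.one_sub_le_exp_neg t]
        _ = t ^ (1 : ℝ) := (Real.rpow_one t).symm
        _ ≤ t ^ s := Real.rpow_le_rpow_of_exponent_ge ht h hs1
  · exact (by linarith [Real.exp_pos (-t)] : _ ≤ (1 : ℝ)).trans (Real.one_le_rpow h hs0)

/-- The interpolation `min 1 t ≤ t ^ s` decouples the weights from the distance. -/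
theorem connProb_le {d : ℕ} (hd : 1 ≤ d) {lam α s : ℝ} (hlam : 0 ≤ lam) (hα : 0 ≤ α) (hs0 : 0 ≤ s)
    (hs1 : s ≤ 1) {w : (Fin d → ℤ) → ℝ} (hw : ∀ x, 1 ≤ w x) {x y : Fin d → ℤ} (hxy : x ≠ y) :
    connProb lam α w s(x, y)
      ≤ (max 1 (lam ^ s) * 2 ^ (α * s)) * latticeKernel (α * s / d) (y - x) * (w x * w y) ^ s := by
  have hd0 : (d : ℝ) ≠ 0 := by positivity
  have h1 := one_le_latticeDist hxy
  have h0 : 0 < latticeDist x y := by linarith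
  have hker := latticeDist_rpow_neg_le hxy (r := α * s / d) (by positivity)
  rw [mul_div_cancel₀ _ hd0] at hker
  have hww : 1 ≤ w x * w y := one_le_mul_of_one_le_of_one_le (hw x) (hw y)
  have hk0 := latticeKernel_pos (α * s / d) (y - x)
  have hmain : connProb lam α w s(x, y)
      ≤ max 1 (lam ^ s) * latticeDist x y ^ (-(α * s)) * (w x * w y) ^ s := by
    rw [connProb_mk]
    split_ifs with h
    · rw [h, Real.one_rpow, mul_one]
      exact one_le_mul_of_one_le_of_one_le (le_max_left _ _) (Real.one_le_rpow hww hs0)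
    · refine (one_sub_exp_neg_le_rpow (by positivity) hs0 hs1).trans ?_
      rw [Real.div_rpow (by positivity) (by positivity), Real.mul_rpow hlam (by positivity),
        ← Real.rpow_mul h0.le, Real.rpow_neg h0.le, div_eq_mul_inv]
      calc lam ^ s * (w x * w y) ^ s * (latticeDist x y ^ (α * s))⁻¹
          ≤ max 1 (lam ^ s) * (w x * w y) ^ s * (latticeDist x y ^ (α * s))⁻¹ := by
            gcongr; exact le_max_right _ _
        _ = _ := by ring
  refine hmain.trans ?_
  calc max 1 (lam ^ s) * latticeDist x y ^ (-(α * s)) * (w x * w y) ^ s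
      ≤ max 1 (lam ^ s) * (2 ^ (α * s) * latticeKernel (α * s / d) (y - x)) * (w x * w y) ^ s := by
        gcongr
    _ = _ := by ring

/-- The weights along a path of length `k` whose first `k` weights are at most `u i` and whose last
weight is at least `v`: each inner weight, which occurs with exponent `2 s`, is truncated to the
integrable exponent `β`. -/
theorem prod_mul_rpow_le {k : ℕ} {a : Fin (k + 1) → ℝ} {u : Fin k → ℝ} {v s β : ℝ}
    (ha : ∀ i, 1 ≤ a i) (hau : ∀ i : Fin k, a i.castSucc ≤ u i) (hv : 0 < v)
    (hva : v ≤ a (Fin.last k)) (hs : 0 ≤ s) (hsβ : s ≤ β) (hβs : β ≤ 2 * s) :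
    ∏ i : Fin k, (a i.castSucc * a i.succ) ^ s
      ≤ (∏ i, u i ^ (2 * s - β)) * v ^ (-(β - s)) * ∏ i, a i ^ β := by
  have ha0 : ∀ i, 0 < a i := fun i => zero_lt_one.trans_le (ha i)
  have h1 : ∏ i : Fin k, (a i.castSucc * a i.succ) ^ s
      ≤ ∏ i : Fin k, u i ^ (2 * s - β) * a i.castSucc ^ (β - s) * a i.succ ^ s := by
    refine Finset.prod_le_prod
      (fun i _ => by have := ha0 i.castSucc; have := ha0 i.succ; positivity) fun i _ => ?_
    have e : a i.castSucc ^ s = a i.castSucc ^ (2 * s - β) * a i.castSucc ^ (β - s) := by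
      rw [← Real.rpow_add (ha0 _)]; congr 1; ring
    rw [Real.mul_rpow (ha0 _).le (ha0 _).le, e]
    have := ha0 i.castSucc
    have := ha0 i.succ
    have hle : a i.castSucc ^ (2 * s - β) ≤ u i ^ (2 * s - β) :=
      Real.rpow_le_rpow (ha0 _).le (hau i) (by linarith)
    gcongr
  have h2 : ∏ i : Fin k, a i.castSucc ^ (β - s) ≤ v ^ (-(β - s)) * ∏ i, a i ^ (β - s) := by
    rw [Fin.prod_univ_castSucc, Real.rpow_neg hv.le, ← div_eq_inv_mul, le_div_iff₀ (by positivity)]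
    refine mul_le_mul_of_nonneg_left (Real.rpow_le_rpow hv.le hva (by linarith))
      (Finset.prod_nonneg fun i _ => (Real.rpow_pos_of_pos (ha0 _) _).le)
  have h3 : ∏ i : Fin k, a i.succ ^ s ≤ ∏ i, a i ^ s := by
    rw [Fin.prod_univ_succ (fun i => a i ^ s)]
    exact le_mul_of_one_le_left (Finset.prod_nonneg fun i _ => (Real.rpow_pos_of_pos (ha0 _) _).le)
      (Real.one_le_rpow (ha 0) hs)
  have h4 : ∏ i, a i ^ β = (∏ i, a i ^ (β - s)) * ∏ i, a i ^ s := by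
    rw [← Finset.prod_mul_distrib]
    refine Finset.prod_congr rfl fun i _ => ?_
    rw [← Real.rpow_add (ha0 i)]; congr 1; ring
  refine h1.trans ?_
  rw [Finset.prod_mul_distrib, Finset.prod_mul_distrib, h4, mul_assoc, mul_assoc]
  have hu : ∀ i, 0 ≤ u i := fun i => (ha0 _).le.trans (hau i)
  refine mul_le_mul_of_nonneg_left ?_ (Finset.prod_nonneg fun i _ => Real.rpow_nonneg (hu i) _)
  rw [← mul_assoc]
  exact mul_le_mul h2 h3 (Finset.prod_nonneg fun i _ => (Real.rpow_pos_of_pos (ha0 _) _).le)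
    (mul_nonneg (by positivity) (Finset.prod_nonneg fun i _ => (Real.rpow_pos_of_pos (ha0 _) _).le))

/-- `c` is a path of the graph `G ω` along which all weights but the last are at most `u i`, the
last weight is at least `v`, and the edge-lengths belong to `B i`. -/
def IsTruncatedPath {d : ℕ} {Ω : Type*} (W : (Fin d → ℤ) → Ω → ℝ)
    (G : Ω → SimpleGraph (Fin d → ℤ)) (L : Sym2 (Fin d → ℤ) → Ω → ℝ) {k : ℕ} (u : Fin k → ℝ)
    (v : ℝ) (B : Fin k → Set ℝ) (c : Fin (k + 1) → Fin d → ℤ) (ω : Ω) : Prop :=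
  (∀ i : Fin k, (G ω).Adj (c i.castSucc) (c i.succ)) ∧
  (∀ i : Fin k, W (c i.castSucc) ω ≤ u i) ∧ v ≤ W (c (Fin.last k)) ω ∧
  ∀ i : Fin k, L s(c i.castSucc, c i.succ) ω ∈ B i

namespace IsWeightedScaleFreePercolation

variable {d : ℕ} {Ω : Type*} [MeasurableSpace Ω] {μ : Measure Ω}
  {lam α : ℝ} {PW PL : Measure ℝ} {W : (Fin d → ℤ) → Ω → ℝ}
  {G : Ω → SimpleGraph (Fin d → ℤ)} {L : Sym2 (Fin d → ℤ) → Ω → ℝ}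

/-- The probability of a given truncated path: by independence of the weights and the decoupling of
`connProb_le`, it is at most a product over the steps of the path. -/
theorem measure_isTruncatedPath_le [IsProbabilityMeasure μ] [IsProbabilityMeasure PL]
    (h : IsWeightedScaleFreePercolation μ lam α PW PL W G L) (hd : 1 ≤ d) (hlam : 0 ≤ lam)
    (hα : 0 ≤ α) (hW1 : ∀ᵐ w ∂PW, 1 ≤ w) {s β : ℝ} (hs0 : 0 ≤ s) (hs1 : s ≤ 1) (hsβ : s ≤ β)
    (hβs : β ≤ 2 * s) {k : ℕ} {u : Fin k → ℝ} (hu : ∀ i, 0 ≤ u i) {v : ℝ} (hv : 0 < v)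
    {B : Fin k → Set ℝ} (hB : ∀ i, MeasurableSet (B i)) {c : Fin (k + 1) → Fin d → ℤ}
    (hc : Function.Injective c) :
    μ {ω | IsTruncatedPath W G L u v B c ω}
      ≤ (∏ i, PL (B i)) * (∏ i, ENNReal.ofReal (u i ^ (2 * s - β)))
        * ENNReal.ofReal (v ^ (-(β - s)))
        * (∏ i : Fin k, ENNReal.ofReal (max 1 (lam ^ s) * 2 ^ (α * s))
            * ENNReal.ofReal (latticeKernel (α * s / d) (c i.succ - c i.castSucc)))
        * (∫⁻ w, ENNReal.ofReal (w ^ β) ∂PW) ^ (k + 1) := by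
  classical
  set edge : Fin k → Sym2 (Fin d → ℤ) := fun i => s(c i.castSucc, c i.succ) with hedge
  have hne : ∀ i : Fin k, c i.castSucc ≠ c i.succ := fun i hi =>
    absurd (hc hi) (Fin.castSucc_lt_succ).ne
  have hinj : Function.Injective edge := by
    intro i j hij
    rcases Sym2.eq_iff.1 hij with ⟨h1, -⟩ | ⟨h1, h2⟩
    · exact Fin.castSucc_injective _ (hc h1)
    · have e1 := congrArg Fin.val (hc h1)
      have e2 := congrArg Fin.val (hc h2)
      simp at e1 e2
      omega
  set T := Finset.univ.image edge
  set A' : Set ((Fin d → ℤ) → ℝ) :=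
    {w | (∀ i : Fin k, w (c i.castSucc) ≤ u i) ∧ v ≤ w (c (Fin.last k))}
  have hA' : MeasurableSet A' := by
    have : A' = (⋂ i : Fin k, {w | w (c i.castSucc) ≤ u i}) ∩ {w | v ≤ w (c (Fin.last k))} := by
      ext; simp [A']
    rw [this]
    exact (MeasurableSet.iInter fun i =>
      measurableSet_le (measurable_pi_apply _) measurable_const).inter
      (measurableSet_le measurable_const (measurable_pi_apply _))
  set A : Set Ω := (fun ω x => W x ω) ⁻¹' A'
  have hA : MeasurableSet[weightSigma W] A := ⟨A', hA', rfl⟩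
  set B' : Sym2 (Fin d → ℤ) → Set ℝ := Function.extend edge B fun _ => Set.univ
  have hB'e : ∀ i, B' (edge i) = B i := fun i => hinj.extend_apply _ _ _
  have hB' : ∀ e, MeasurableSet (B' e) := by
    intro e
    by_cases he : ∃ i, edge i = e
    · obtain ⟨i, rfl⟩ := he
      rw [hB'e]; exact hB i
    · rw [show B' e = Set.univ from Function.extend_apply' _ _ _ he]
      exact MeasurableSet.univ
  have hT : ∀ e ∈ T, ¬ e.IsDiag := by
    intro e he
    obtain ⟨i, -, rfl⟩ := Finset.mem_image.1 he
    simpa [hedge, Sym2.mk_isDiag_iff] using hne i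
  have hset : {ω | IsTruncatedPath W G L u v B c ω}
      = A ∩ {ω | ∀ e ∈ T, e ∈ (G ω).edgeSet ∧ L e ω ∈ B' e} := by
    ext ω
    simp only [IsTruncatedPath, Set.mem_ofPred_eq, Set.mem_inter_iff, A, A', Set.mem_preimage, T,
      Finset.mem_image, Finset.mem_univ, true_and, forall_exists_index,
      forall_apply_eq_imp_iff, hB'e]
    simp only [hedge, SimpleGraph.mem_edgeSet, forall_and]
    tauto
  have hform := h.measureReal_forall_edge hT hA hB'
  have hW := h.ae_weight hW1
  set F : Ω → ℝ := fun ω => ∏ e ∈ T, (connProb lam α (fun x => W x ω) e * PL.real (B' e)) with hF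
  have hF' : ∀ ω, F ω = (∏ i, connProb lam α (fun x => W x ω) (edge i)) * ∏ i, PL.real (B i) := by
    intro ω
    rw [hF, ← Finset.prod_mul_distrib]
    simp only [T]
    rw [Finset.prod_image hinj.injOn]
    simp only [hB'e]
  have hF01 : ∀ᵐ ω ∂μ, F ω ∈ Set.Icc 0 1 := by
    filter_upwards [hW] with ω hω
    have h1 := connProb_mem_Icc (α := α) hlam (fun x => zero_le_one.trans (hω x))
    have h2 : ∀ e, connProb lam α (fun x => W x ω) e * PL.real (B' e) ∈ Set.Icc 0 1 := fun e =>
      ⟨mul_nonneg (h1 e).1 measureReal_nonneg,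
        mul_le_one₀ (h1 e).2 measureReal_nonneg measureReal_le_one⟩
    exact ⟨Finset.prod_nonneg fun e _ => (h2 e).1,
      Finset.prod_le_one (fun e _ => (h2 e).1) fun e _ => (h2 e).2⟩
  have hFm : Measurable F := Finset.measurable_prod _ fun e _ =>
    (measurable_connProb h.measurable_weight lam α e).mul_const _
  have hFi : Integrable F (μ.restrict A) :=
    Integrable.of_bound (C := 1) hFm.aestronglyMeasurable
      (ae_restrict_of_ae (hF01.mono fun ω hω => by
        rw [Real.norm_of_nonneg hω.1]; exact hω.2))
  rw [hset, ← ENNReal.ofReal_toReal (measure_ne_top μ _), ← measureReal_def, hform,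
    ofReal_integral_eq_lintegral_ofReal hFi (ae_restrict_of_ae (hF01.mono fun ω hω => hω.1))]
  have hmeas : ∀ x, Measurable fun ω => ENNReal.ofReal (W x ω ^ β) := fun x =>
    ((h.measurable_weight x).pow_const β).ennreal_ofReal
  have hprod : ∫⁻ ω, ∏ i, ENNReal.ofReal (W (c i) ω ^ β) ∂μ
      = (∫⁻ w, ENNReal.ofReal (w ^ β) ∂PW) ^ (k + 1) := by
    have hind : iIndepFun (fun i ω => ENNReal.ofReal (W (c i) ω ^ β)) μ :=
      (h.indep_weight.precomp hc).comp (fun _ w => ENNReal.ofReal (w ^ β))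
        fun _ => (measurable_id.pow_const β).ennreal_ofReal
    rw [lintegral_prod_eq_prod_lintegral_of_indepFun _ _ hind fun i => hmeas _]
    have : ∀ i, ∫⁻ ω, ENNReal.ofReal (W (c i) ω ^ β) ∂μ = ∫⁻ w, ENNReal.ofReal (w ^ β) ∂PW := by
      intro i
      rw [← h.law_weight (c i), lintegral_map (f := fun w => ENNReal.ofReal (w ^ β))
        ((measurable_id.pow_const β).ennreal_ofReal) (h.measurable_weight _)]
    simp [this]
  rw [← hprod, ← lintegral_const_mul _ (Finset.measurable_prod _ fun i _ => hmeas _)]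
  refine (lintegral_mono_ae ?_).trans (setLIntegral_le_lintegral A _)
  filter_upwards [ae_restrict_of_ae hW, ae_restrict_mem (h.weightSigma_le _ hA)] with ω hω hωA
  have hk0 : ∀ i : Fin k, 0 ≤ latticeKernel (α * s / d) (c i.succ - c i.castSucc) := fun i =>
    (latticeKernel_pos _ _).le
  have hpos : ∀ x, 0 < W x ω := fun x => zero_lt_one.trans_le (hω x)
  have hreal : ∏ i, connProb lam α (fun x => W x ω) (edge i)
      ≤ (∏ i : Fin k, (max 1 (lam ^ s) * 2 ^ (α * s))
          * latticeKernel (α * s / d) (c i.succ - c i.castSucc))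
        * ((∏ i, u i ^ (2 * s - β)) * v ^ (-(β - s)) * ∏ i, W (c i) ω ^ β) := by
    have h1 := prod_mul_rpow_le (a := fun i => W (c i) ω) (u := u) (fun i => hω _) hωA.1 hv hωA.2
      hs0 hsβ hβs
    refine le_trans ?_ (mul_le_mul_of_nonneg_left h1
      (Finset.prod_nonneg fun i _ => mul_nonneg (by positivity) (hk0 i)))
    rw [← Finset.prod_mul_distrib]
    exact Finset.prod_le_prod
      (fun i _ => (connProb_mem_Icc hlam (fun x => (hpos x).le) _).1)
      fun i _ => connProb_le hd hlam hα hs0 hs1 hω (hne i)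
  have hPL : ENNReal.ofReal (∏ i, PL.real (B i)) = ∏ i, PL (B i) := by
    rw [ENNReal.ofReal_prod_of_nonneg fun _ _ => measureReal_nonneg]
    simp [measureReal_def]
  rw [hF', ENNReal.ofReal_mul' (Finset.prod_nonneg fun _ _ => measureReal_nonneg), hPL]
  refine (mul_le_mul_left (ENNReal.ofReal_le_ofReal hreal) _).trans (le_of_eq ?_)
  rw [ENNReal.ofReal_mul (Finset.prod_nonneg fun i _ => mul_nonneg (by positivity) (hk0 i)),
    ENNReal.ofReal_mul (mul_nonneg (Finset.prod_nonneg fun i _ => Real.rpow_nonneg (hu i) _)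
      (by positivity)),
    ENNReal.ofReal_mul (Finset.prod_nonneg fun i _ => Real.rpow_nonneg (hu i) _),
    ENNReal.ofReal_prod_of_nonneg fun i _ => mul_nonneg (by positivity) (hk0 i),
    ENNReal.ofReal_prod_of_nonneg fun i _ => Real.rpow_nonneg (hu i) _,
    ENNReal.ofReal_prod_of_nonneg fun i _ => Real.rpow_nonneg (hpos _).le _]
  have : ∀ i : Fin k, ENNReal.ofReal ((max 1 (lam ^ s) * 2 ^ (α * s))
        * latticeKernel (α * s / d) (c i.succ - c i.castSucc))
      = ENNReal.ofReal (max 1 (lam ^ s) * 2 ^ (α * s))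
        * ENNReal.ofReal (latticeKernel (α * s / d) (c i.succ - c i.castSucc)) := fun i =>
    ENNReal.ofReal_mul (by positivity)
  simp_rw [this]
  ring

end IsWeightedScaleFreePercolation

/-! ### Upper bounds on the growth of balls -/

theorem summable_pow_mul_exp_neg {Q c b : ℝ} (hQ : 0 ≤ Q) (hc : 0 < c) (hb : 1 < b) :
    Summable fun k : ℕ => Q ^ k * Real.exp (-(c * b ^ k)) := by
  have hlim := tendsto_pow_const_div_const_pow_of_one_lt 1 hb
  set M := Real.log (2 * (Q + 1))
  have hM : 0 < M := Real.log_pos (by linarith)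
  have hev := hlim.eventually_lt_const (show 0 < c / M by positivity)
  refine Summable.of_norm_bounded_eventually_nat (g := fun k => (1 / 2 : ℝ) ^ k)
    (summable_geometric_of_lt_one (by norm_num) (by norm_num)) ?_
  filter_upwards [hev] with k hk
  rw [Real.norm_of_nonneg (by positivity)]
  have h1 : k * M ≤ c * b ^ k := by
    rw [pow_one, div_lt_div_iff₀ (by positivity) hM] at hk
    exact hk.le
  have h2 : Real.exp (-(c * b ^ k)) ≤ ((2 * (Q + 1)) ^ k)⁻¹ := by
    rw [← Real.exp_log (show (0 : ℝ) < 2 * (Q + 1) by linarith), ← Real.exp_nat_mul,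
      ← Real.exp_neg]
    exact Real.exp_le_exp.2 (neg_le_neg h1)
  calc Q ^ k * Real.exp (-(c * b ^ k)) ≤ (Q + 1) ^ k * ((2 * (Q + 1)) ^ k)⁻¹ := by
        gcongr; linarith
    _ = (1 / 2 : ℝ) ^ k := by
        rw [mul_pow, one_div, inv_pow, mul_inv, mul_comm, mul_assoc,
          inv_mul_cancel₀ (by positivity), mul_one]

theorem tsum_pow_mul_exp_neg_ne_top {Q : ℝ≥0∞} (hQ : Q ≠ ∞) {c b : ℝ} (hc : 0 < c)
    (hb : 1 < b) : ∑' k : ℕ, Q ^ k * ENNReal.ofReal (Real.exp (-(c * b ^ k))) ≠ ∞ := by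
  have h :=
    (summable_pow_mul_exp_neg (Q := Q.toReal) ENNReal.toReal_nonneg hc hb).tsum_ofReal_ne_top
  convert h using 3 with k
  rw [ENNReal.ofReal_mul (by positivity), ← ENNReal.toReal_pow,
    ENNReal.ofReal_toReal (ENNReal.pow_ne_top hQ)]

theorem sum_pow_add_le {b : ℝ} (hb : 1 < b) (j k : ℕ) :
    ∑ i : Fin k, b ^ ((i : ℕ) + j) ≤ b ^ (k + j) / (b - 1) := by
  have hb0 : 0 < b - 1 := by linarith
  induction k with
  | zero => simpa using by positivity
  | succ k ih =>
    rw [Fin.sum_univ_castSucc]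
    simp only [Fin.val_castSucc, Fin.val_last]
    refine (add_le_add_left ih _).trans (le_of_eq ?_)
    field_simp
    ring

theorem prod_exp_pow_rpow_le {b σ : ℝ} (hb : 1 < b) (hσ : 0 ≤ σ) (j k : ℕ) :
    ∏ i : Fin k, Real.exp (b ^ ((i : ℕ) + j)) ^ σ ≤ Real.exp (σ / (b - 1) * b ^ (k + j)) := by
  simp_rw [← Real.exp_mul]
  rw [← Real.exp_sum, ← Finset.sum_mul]
  refine Real.exp_le_exp.2 ((mul_le_mul_of_nonneg_right (sum_pow_add_le hb j k) hσ).trans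
    (le_of_eq ?_))
  ring

section Geodesic

variable {V : Type*} {G : SimpleGraph V}

/-- A shortest path, given by its vertices: the `i`-th one is at distance `i` from `x`. -/
theorem exists_geodesic (hG : G.Connected) {x y : V} {k : ℕ} (hk : G.dist x y = k) :
    ∃ c : Fin (k + 1) → V, c 0 = x ∧ c (Fin.last k) = y ∧
      (∀ i : Fin k, G.Adj (c i.castSucc) (c i.succ)) ∧ ∀ i, G.dist x (c i) = i := by
  obtain ⟨p, hp⟩ := hG.exists_walk_length_eq_dist x y
  rw [hk] at hp
  refine ⟨fun i => p.getVert i, by simp, by simp [← hp], fun i => ?_, fun i => ?_⟩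
  · exact p.adj_getVert_succ (by rw [hp]; exact i.2)
  · have h1 : G.dist x (p.getVert i) ≤ i := (SimpleGraph.dist_le (p.take i)).trans (by simp)
    have h2 : G.dist (p.getVert i) y ≤ k - i :=
      (SimpleGraph.dist_le (p.drop i)).trans (by simp [hp])
    have h3 := hG.dist_triangle (u := x) (v := p.getVert i) (w := y)
    have := i.2
    show G.dist x (p.getVert i) = i
    omega

theorem injective_of_dist_eq {x : V} {k : ℕ} {c : Fin k → V}
    (hc : ∀ i, G.dist x (c i) = i) : Function.Injective c := fun i j hij =>
  Fin.ext (by rw [← hc i, ← hc j, hij])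

end Geodesic

namespace IsWeightedScaleFreePercolation

variable {d : ℕ} {Ω : Type*} [MeasurableSpace Ω] {μ : Measure Ω} [IsProbabilityMeasure μ]
  {lam α : ℝ} {PW PL : Measure ℝ} [IsProbabilityMeasure PL] {W : (Fin d → ℤ) → Ω → ℝ}
  {G : Ω → SimpleGraph (Fin d → ℤ)} {L : Sym2 (Fin d → ℤ) → Ω → ℝ}

/-- First moment bound for the truncated paths of length `k` from `x`: up to the effect of the
truncation, it is geometric in `k`. -/
theorem exists_measure_exists_isTruncatedPath_le
    (h : IsWeightedScaleFreePercolation μ lam α PW PL W G L) (hd : 1 ≤ d) (hlam : 0 ≤ lam)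
    (hα : 0 ≤ α) (hW1 : ∀ᵐ w ∂PW, 1 ≤ w) {s β : ℝ} (hs0 : 0 ≤ s) (hs1 : s ≤ 1) (hsβ : s ≤ β)
    (hβs : β ≤ 2 * s) (hsd : d < α * s) (hmom : ∫⁻ w, ENNReal.ofReal (w ^ β) ∂PW < ∞) :
    ∃ m Q : ℝ≥0∞, m ≠ ∞ ∧ Q ≠ ∞ ∧ 1 ≤ Q ∧ ∀ (x : Fin d → ℤ) (k : ℕ) (u : Fin k → ℝ) (v : ℝ)
      (B : Fin k → Set ℝ), (∀ i, 0 ≤ u i) → 0 < v → (∀ i, MeasurableSet (B i)) →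
      μ {ω | ∃ c : Fin (k + 1) → Fin d → ℤ, c 0 = x ∧ Function.Injective c ∧
          IsTruncatedPath W G L u v B c ω}
        ≤ m * Q ^ k * (∏ i, PL (B i)) * ENNReal.ofReal (∏ i, u i ^ (2 * s - β))
          * ENNReal.ofReal (v ^ (-(β - s))) := by
  set m := ∫⁻ w, ENNReal.ofReal (w ^ β) ∂PW
  set C := ENNReal.ofReal (max 1 (lam ^ s) * 2 ^ (α * s))
  set f : (Fin d → ℤ) → ℝ≥0∞ := fun z => C * ENNReal.ofReal (latticeKernel (α * s / d) z)
  have hd0 : (0 : ℝ) < d := by exact_mod_cast hd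
  have hf : ∑' z, f z ≠ ∞ := by
    rw [ENNReal.tsum_mul_left]
    exact ENNReal.mul_ne_top ENNReal.ofReal_ne_top
      (tsum_latticeKernel_lt_top d ((one_lt_div hd0).2 hsd)).ne
  refine ⟨m, max 1 ((∑' z, f z) * m), hmom.ne,
    (max_lt ENNReal.one_lt_top (ENNReal.mul_lt_top hf.lt_top hmom)).ne, le_max_left _ _, ?_⟩
  intro x k u v B hu hv hB
  set K : ℝ≥0∞ := (∏ i, PL (B i)) * (∏ i, ENNReal.ofReal (u i ^ (2 * s - β)))
    * ENNReal.ofReal (v ^ (-(β - s)))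
  have hsub : {ω | ∃ c : Fin (k + 1) → Fin d → ℤ, c 0 = x ∧ Function.Injective c ∧
      IsTruncatedPath W G L u v B c ω}
      ⊆ ⋃ z : Fin k → Fin d → ℤ, {ω | Function.Injective (Fin.cons x z : Fin (k + 1) → _) ∧
        IsTruncatedPath W G L u v B (Fin.cons x z) ω} := by
    rintro ω ⟨c, rfl, hc⟩
    refine Set.mem_iUnion.2 ⟨Fin.tail c, ?_⟩
    rw [Fin.cons_self_tail]
    exact hc
  have hz : ∀ z : Fin k → Fin d → ℤ,
      μ {ω | Function.Injective (Fin.cons x z : Fin (k + 1) → _) ∧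
        IsTruncatedPath W G L u v B (Fin.cons x z) ω}
      ≤ K * (∏ i, f (z i - (Fin.cons x z : Fin (k + 1) → Fin d → ℤ) i.castSucc)) * m ^ (k + 1) := by
    intro z
    by_cases hinj : Function.Injective (Fin.cons x z : Fin (k + 1) → Fin d → ℤ)
    · have := h.measure_isTruncatedPath_le hd hlam hα hW1 hs0 hs1 hsβ hβs hu hv hB hinj
      simpa only [hinj, true_and, Fin.cons_succ] using this
    · simp [hinj]
  refine (measure_mono hsub).trans ((measure_iUnion_le _).trans
    ((ENNReal.tsum_le_tsum hz).trans ?_))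
  rw [ENNReal.tsum_mul_right, ENNReal.tsum_mul_left, tsum_path_prod]
  calc K * (∑' z, f z) ^ k * m ^ (k + 1) = m * ((∑' z, f z) * m) ^ k * K := by ring
    _ ≤ m * (max 1 ((∑' z, f z) * m)) ^ k * K := by gcongr; exact le_max_right _ _
    _ = _ := by
      rw [ENNReal.ofReal_prod_of_nonneg fun i _ => Real.rpow_nonneg (hu i) _]
      simp only [K]
      ring

/-- The expected number of neighbours of `x` is finite if the weight of `x` is truncated. -/
theorem ae_locallyFinite
    (h : IsWeightedScaleFreePercolation μ lam α PW PL W G L) (hd : 1 ≤ d) (hlam : 0 ≤ lam)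
    (hα : 0 ≤ α) (hW1 : ∀ᵐ w ∂PW, 1 ≤ w) {s β : ℝ} (hs0 : 0 ≤ s) (hs1 : s ≤ 1) (hsβ : s ≤ β)
    (hβs : β ≤ 2 * s) (hsd : d < α * s) (hmom : ∫⁻ w, ENNReal.ofReal (w ^ β) ∂PW < ∞) :
    ∀ᵐ ω ∂μ, ∀ x, ((G ω).neighborSet x).Finite := by
  have hd0 : (0 : ℝ) < d := by exact_mod_cast hd
  have hfin : ∀ (x : Fin d → ℤ) (K : ℕ),
      ∀ᵐ ω ∂μ, {y | (G ω).Adj x y ∧ W x ω ≤ K ∧ 1 ≤ W y ω}.Finite := by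
    intro x K
    refine ae_finite_setOfPred_mem (s := fun y => {ω | (G ω).Adj x y ∧ W x ω ≤ K ∧ 1 ≤ W y ω}) ?_
    have hle : ∀ y, μ {ω | (G ω).Adj x y ∧ W x ω ≤ K ∧ 1 ≤ W y ω}
        ≤ ENNReal.ofReal ((K : ℝ) ^ (2 * s - β))
          * (ENNReal.ofReal (max 1 (lam ^ s) * 2 ^ (α * s))
            * ENNReal.ofReal (latticeKernel (α * s / d) (y - x)))
          * (∫⁻ w, ENNReal.ofReal (w ^ β) ∂PW) ^ 2 := by
      intro y
      by_cases hxy : x = y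
      · simp [hxy]
      · have := h.measure_isTruncatedPath_le hd hlam hα hW1 hs0 hs1 hsβ hβs (k := 1)
          (u := fun _ => (K : ℝ)) (fun _ => Nat.cast_nonneg K) one_pos (B := fun _ => Set.univ)
          (fun _ => MeasurableSet.univ) (c := ![x, y])
          (by
            intro i j hij
            fin_cases i <;> fin_cases j <;> simp_all [eq_comm])
        simpa [IsTruncatedPath] using this
    refine ((ENNReal.tsum_le_tsum hle).trans_lt ?_).ne
    have hshift : ∑' y, ENNReal.ofReal (latticeKernel (α * s / d) (y - x))
        = ∑' z : Fin d → ℤ, ENNReal.ofReal (latticeKernel (α * s / d) z) :=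
      (Equiv.subRight x).tsum_eq fun z => ENNReal.ofReal (latticeKernel (α * s / d) z)
    rw [ENNReal.tsum_mul_right, ENNReal.tsum_mul_left, ENNReal.tsum_mul_left, hshift]
    exact ENNReal.mul_lt_top (ENNReal.mul_lt_top ENNReal.ofReal_lt_top
      (ENNReal.mul_lt_top ENNReal.ofReal_lt_top
        (tsum_latticeKernel_lt_top d ((one_lt_div hd0).2 hsd)))) (ENNReal.pow_lt_top hmom)
  filter_upwards [h.ae_weight hW1, ae_all_iff.2 fun x => ae_all_iff.2 (hfin x)] with ω hω hf x
  obtain ⟨K, hK⟩ := exists_nat_ge (W x ω)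
  exact (hf x K).subset fun y hy => ⟨hy, hK, hω y⟩

/-- The weights in the ball of radius `n` grow at most like `exp (b ^ (n + j))`. -/
theorem ae_exists_weight_le
    (h : IsWeightedScaleFreePercolation μ lam α PW PL W G L) (hd : 1 ≤ d) (hlam : 0 ≤ lam)
    (hα : 0 ≤ α) (hW1 : ∀ᵐ w ∂PW, 1 ≤ w) {s β b : ℝ} (hs0 : 0 ≤ s) (hs1 : s ≤ 1) (hsβ : s ≤ β)
    (hβs : β ≤ 2 * s) (hsd : d < α * s) (hmom : ∫⁻ w, ENNReal.ofReal (w ^ β) ∂PW < ∞)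
    (hb : 1 < b) (hsb : (b + 1) * s < b * β) (x : Fin d → ℤ) :
    ∀ᵐ ω ∂μ, ∃ j : ℕ, ∀ y, W y ω ≤ Real.exp (b ^ ((G ω).dist x y + j)) := by
  obtain ⟨m, Q, hm, hQ, hQ1, hbound⟩ :=
    h.exists_measure_exists_isTruncatedPath_le hd hlam hα hW1 hs0 hs1 hsβ hβs hsd hmom
  -- the gain `β - s` from the last weight beats the total loss from the truncation of the others
  set κ : ℝ := (β - s) - (2 * s - β) / (b - 1) with hκ
  have hκ0 : 0 < κ := by
    rw [hκ, sub_pos, div_lt_iff₀ (by linarith)]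
    linarith
  -- a path of length `k` on which the last weight is the first one to exceed its threshold
  set bad : ℕ → ℕ → Set Ω := fun j k => {ω | ∃ c : Fin (k + 1) → Fin d → ℤ, c 0 = x ∧
    Function.Injective c ∧ IsTruncatedPath W G L (fun i : Fin k => Real.exp (b ^ ((i : ℕ) + j)))
      (Real.exp (b ^ (k + j))) (fun _ => Set.univ) c ω}
  set f : ℕ → ℝ≥0∞ := fun n => Q ^ n * ENNReal.ofReal (Real.exp (-(κ * b ^ n)))
  have hbad : ∀ j k, μ (bad j k) ≤ m * f (k + j) := by
    intro j k
    refine (hbound x k _ _ _ (fun _ => (Real.exp_pos _).le) (Real.exp_pos _)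
      (fun _ => MeasurableSet.univ)).trans ?_
    simp only [measure_univ, Finset.prod_const_one, mul_one]
    rw [mul_assoc, ← ENNReal.ofReal_mul (Finset.prod_nonneg fun _ _ => by positivity), mul_assoc]
    have hexp : (∏ i : Fin k, Real.exp (b ^ ((i : ℕ) + j)) ^ (2 * s - β))
        * Real.exp (b ^ (k + j)) ^ (-(β - s)) ≤ Real.exp (-(κ * b ^ (k + j))) := by
      calc _ ≤ Real.exp ((2 * s - β) / (b - 1) * b ^ (k + j))
            * Real.exp (b ^ (k + j)) ^ (-(β - s)) := by
            gcongr
            exact prod_exp_pow_rpow_le hb (by linarith) j k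
        _ = _ := by
            rw [← Real.exp_mul, ← Real.exp_add, hκ]
            congr 1; ring
    exact mul_le_mul' le_rfl (mul_le_mul' (pow_le_pow_right₀ hQ1 (Nat.le_add_right k j))
      (ENNReal.ofReal_le_ofReal hexp))
  have hf : ∑' n, f n ≠ ∞ := tsum_pow_mul_exp_neg_ne_top hQ hκ0 hb
  -- the shift `j` turns the union bound over `k` into a tail of one convergent series
  have hlim : Tendsto (fun j => m * ∑' k, f (k + j)) atTop (𝓝 0) := by
    have := ENNReal.Tendsto.const_mul (a := m) (ENNReal.tendsto_sum_nat_add f hf) (Or.inr hm)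
    rwa [mul_zero] at this
  have hnull : μ (⋂ j, ⋃ k, bad j k) = 0 := by
    refine le_antisymm (ge_of_tendsto' hlim fun j => ?_) zero_le
    refine (measure_mono (Set.iInter_subset _ j)).trans ((measure_iUnion_le _).trans ?_)
    rw [← ENNReal.tsum_mul_left]
    exact ENNReal.tsum_le_tsum fun k => hbad j k
  filter_upwards [measure_eq_zero_iff_ae_notMem.1 hnull, h.ae_connected] with ω hω hG
  simp only [Set.mem_iInter, not_forall, Set.mem_iUnion, not_exists] at hω
  obtain ⟨j, hj⟩ := hω
  refine ⟨j, ?_⟩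
  suffices H : ∀ k y, (G ω).dist x y = k → W y ω ≤ Real.exp (b ^ (k + j)) from
    fun y => H _ y rfl
  intro k
  induction k using Nat.strong_induction_on with
  | _ k ih =>
    intro y hy
    by_contra! hcon
    obtain ⟨c, hc0, hcl, hadj, hdist⟩ := exists_geodesic hG hy
    refine hj k ⟨c, hc0, injective_of_dist_eq hdist, hadj, fun i => ?_, ?_, fun _ => trivial⟩
    · exact ih i i.2 _ (hdist i.castSucc)
    · rw [hcl]; exact hcon.le

/-- The lengths of the edges from level `k` to level `k + 1` are at least of the order of the
minimum of `exp (c * b ^ (k + 1))` independent lengths. -/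
theorem ae_exists_length_ge
    (h : IsWeightedScaleFreePercolation μ lam α PW PL W G L) (hd : 1 ≤ d) (hlam : 0 ≤ lam)
    (hα : 0 ≤ α) (hW1 : ∀ᵐ w ∂PW, 1 ≤ w) (hL0 : ∀ᵐ s ∂PL, 0 ≤ s) {s β b : ℝ} (hs0 : 0 ≤ s)
    (hs1 : s ≤ 1) (hsβ : s ≤ β)
    (hβs : β ≤ 2 * s) (hsd : d < α * s) (hmom : ∫⁻ w, ENNReal.ofReal (w ^ β) ∂PW < ∞)
    (hb : 1 < b) (hsb : (b + 1) * s < b * β) (x : Fin d → ℤ) :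
    ∀ᵐ ω ∂μ, ∃ c : ℝ, 0 < c ∧ ∀ᶠ k : ℕ in atTop, ∀ y z, (G ω).Adj y z → (G ω).dist x y = k →
      (G ω).dist x z = k + 1 → quantile PL (Real.exp (-(c * b ^ (k + 1)))) ≤ L s(y, z) ω := by
  obtain ⟨m, Q, hm, hQ, hQ1, hbound⟩ :=
    h.exists_measure_exists_isTruncatedPath_le hd hlam hα hW1 hs0 hs1 hsβ hβs hsd hmom
  -- `exp (C j * b ^ (k + 1))` exceeds the truncation losses by the summable factor
  -- `exp (b ^ (k + 1))`
  set C : ℕ → ℝ := fun j => (2 * s - β) / (b - 1) * b ^ j + 1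
  have hC : ∀ j, 0 < C j := fun j => by
    have : 0 ≤ (2 * s - β) / (b - 1) := div_nonneg (by linarith) (by linarith)
    positivity
  set B : ℕ → (k : ℕ) → Fin (k + 1) → Set ℝ := fun j k i =>
    if i = Fin.last k then Set.Iio (quantile PL (Real.exp (-(C j * b ^ (k + 1))))) else Set.univ
  set bad : ℕ → ℕ → Set Ω := fun j k => {ω | ∃ c : Fin (k + 1 + 1) → Fin d → ℤ, c 0 = x ∧
    Function.Injective c ∧ IsTruncatedPath W G L
      (fun i : Fin (k + 1) => Real.exp (b ^ ((i : ℕ) + j))) 1 (B j k) c ω}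
  have hbad : ∀ j k, μ (bad j k)
      ≤ m * (Q ^ (k + 1) * ENNReal.ofReal (Real.exp (-(1 * b ^ (k + 1))))) := by
    intro j k
    refine (hbound x (k + 1) _ _ _ (fun _ => (Real.exp_pos _).le) one_pos (fun i => ?_)).trans ?_
    · simp only [B]; split_ifs
      · exact measurableSet_Iio
      · exact MeasurableSet.univ
    have hB : ∏ i, PL (B j k i) ≤ ENNReal.ofReal (Real.exp (-(C j * b ^ (k + 1)))) := by
      rw [Fin.prod_univ_castSucc]
      have : ∀ i : Fin k, PL (B j k i.castSucc) = 1 := fun i => by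
        simp [B, (Fin.castSucc_lt_last i).ne]
      simp only [this, Finset.prod_const_one, one_mul]
      simp only [B, if_true]
      rw [← ENNReal.ofReal_toReal (measure_ne_top PL _)]
      exact ENNReal.ofReal_le_ofReal (measureReal_Iio_quantile_le hL0 (Real.exp_pos _))
    rw [Real.one_rpow, ENNReal.ofReal_one, mul_one, mul_assoc, mul_assoc]
    gcongr
    refine (mul_le_mul' hB (ENNReal.ofReal_le_ofReal
      (prod_exp_pow_rpow_le hb (by linarith) j (k + 1)))).trans (le_of_eq ?_)
    rw [← ENNReal.ofReal_mul (Real.exp_pos _).le, ← Real.exp_add]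
    congr 2
    simp only [C]
    ring
  have hae : ∀ j, ∀ᵐ ω ∂μ, ∀ᶠ k in atTop, ω ∉ bad j k := by
    intro j
    refine ae_eventually_notMem ((ENNReal.tsum_le_tsum (hbad j)).trans_lt ?_).ne
    rw [ENNReal.tsum_mul_left]
    refine ENNReal.mul_lt_top hm.lt_top (lt_of_le_of_lt ?_
      (tsum_pow_mul_exp_neg_ne_top hQ one_pos hb).lt_top)
    exact ENNReal.tsum_comp_le_tsum_of_injective (add_left_injective 1)
      (fun k => Q ^ k * ENNReal.ofReal (Real.exp (-(1 * b ^ k))))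
  filter_upwards [h.ae_exists_weight_le hd hlam hα hW1 hs0 hs1 hsβ hβs hsd hmom hb hsb x,
    ae_all_iff.2 hae, h.ae_connected, h.ae_weight hW1] with ω ⟨j, hj⟩ hω hG hWω
  refine ⟨C j, hC j, (hω j).mono fun k hk y z hyz hy hz => ?_⟩
  by_contra! hcon
  obtain ⟨c, hc0, hcl, hadj, hdist⟩ := exists_geodesic hG hy
  refine hk ⟨Fin.snoc (α := fun _ => Fin d → ℤ) c z, ?_, ?_, ?_, ?_, hWω _, ?_⟩
  · rw [← Fin.castSucc_zero, Fin.snoc_castSucc, hc0]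
  · refine injective_of_dist_eq (G := G ω) (x := x) fun i => ?_
    induction i using Fin.lastCases with
    | last => simpa using hz
    | cast i => simpa using hdist i
  · intro i
    induction i using Fin.lastCases with
    | last => rwa [Fin.succ_last, Fin.snoc_last, Fin.snoc_castSucc, hcl]
    | cast i =>
      rw [Fin.succ_castSucc, Fin.snoc_castSucc, Fin.snoc_castSucc]
      exact hadj i
  · intro i
    have := hj (c i)
    rw [hdist i] at this
    simpa using this
  · intro i
    induction i using Fin.lastCases with
    | last => simpa [B, hcl] using hcon
    | cast i => simp [B, (Fin.castSucc_lt_last i).ne]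

end IsWeightedScaleFreePercolation

/-! ### Greedy paths -/

/-- A doubly exponentially small factor beats every exponential one. -/
theorem exists_exp_mul_exp_neg_exp_le (A : ℝ) {c η : ℝ} (hc : 0 < c) (hη : 0 < η) :
    ∃ C : ℝ, 0 < C ∧ ∀ X : ℝ, 0 ≤ X →
      Real.exp (A * X) * Real.exp (-(c * Real.exp (η * X))) ≤ C * Real.exp (-X) := by
  refine ⟨Real.exp ((A + 1) ^ 2 / (2 * c * η ^ 2)), Real.exp_pos _, fun X hX => ?_⟩
  rw [← Real.exp_add, ← Real.exp_add, Real.exp_le_exp]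
  have h1 := Real.quadratic_le_exp_of_nonneg (mul_nonneg hη.le hX)
  have h2 : (A + 1) * X ≤ (A + 1) ^ 2 / (2 * c * η ^ 2) + c * ((η * X) ^ 2 / 2) := by
    have h3 : (A + 1) ^ 2 / (2 * c * η ^ 2) + c * ((η * X) ^ 2 / 2) - (A + 1) * X
        = ((A + 1) - c * η ^ 2 * X) ^ 2 / (2 * c * η ^ 2) := by
      field_simp
      ring
    have : 0 ≤ ((A + 1) - c * η ^ 2 * X) ^ 2 / (2 * c * η ^ 2) := by positivity
    linarith
  have h4 : c * ((η * X) ^ 2 / 2) ≤ c * Real.exp (η * X) := by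
    have := mul_nonneg hη.le hX
    gcongr
    linarith
  linarith

/-- The cube `{-⌊D⌋, …, ⌊D⌋} ^ d`. -/
noncomputable def cube (d : ℕ) (D : ℝ) : Finset (Fin d → ℤ) :=
  Finset.Icc (fun _ => -(⌊D⌋₊ : ℤ)) fun _ => (⌊D⌋₊ : ℤ)

theorem card_cube (d : ℕ) (D : ℝ) : (cube d D).card = (2 * ⌊D⌋₊ + 1) ^ d := by
  rw [cube, Pi.card_Icc]
  simp only [Int.card_Icc, Finset.prod_const, Finset.card_univ, Fintype.card_fin]
  congr 1
  omega

theorem pow_le_card_cube (d : ℕ) {D : ℝ} (hD : 0 ≤ D) : D ^ d ≤ (cube d D).card := by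
  rw [card_cube]
  push_cast
  have := Nat.lt_floor_add_one D
  have := Nat.cast_nonneg (α := ℝ) ⌊D⌋₊
  gcongr
  linarith

theorem card_cube_le (d : ℕ) {D : ℝ} (hD : 1 ≤ D) : ((cube d D).card : ℝ) ≤ 3 ^ d * D ^ d := by
  rw [card_cube, ← mul_pow]
  push_cast
  have := Nat.floor_le (zero_le_one.trans hD)
  gcongr
  linarith

theorem two_le_card_cube {d : ℕ} (hd : 1 ≤ d) {D : ℝ} (hD : 1 ≤ D) : 2 ≤ (cube d D).card := by
  rw [card_cube]
  have h1 : 1 ≤ ⌊D⌋₊ := Nat.one_le_floor_iff _ |>.2 hD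
  calc 2 ≤ 2 * ⌊D⌋₊ + 1 := by omega
    _ = (2 * ⌊D⌋₊ + 1) ^ 1 := (pow_one _).symm
    _ ≤ _ := Nat.pow_le_pow_right (by omega) hd

theorem latticeDist_le_of_mem_cube {d : ℕ} {D D' : ℝ} (hD : 0 ≤ D) (hDD : D ≤ D')
    {u v : Fin d → ℤ} (hu : u ∈ cube d D) (hv : v ∈ cube d D') :
    latticeDist u v ≤ 2 * d * D' := by
  have hD' : 0 ≤ D' := hD.trans hDD
  have key : ∀ {E : ℝ} {w : Fin d → ℤ}, 0 ≤ E → w ∈ cube d E → ∀ i, |(w i : ℝ)| ≤ E := by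
    intro E w hE hw i
    rw [cube, Finset.mem_Icc] at hw
    have h1 := hw.1 i
    have h2 := hw.2 i
    have h3 : |(w i : ℝ)| ≤ (⌊E⌋₊ : ℝ) := by
      rw [abs_le]
      constructor
      · exact_mod_cast h1
      · exact_mod_cast h2
    exact h3.trans (Nat.floor_le hE)
  rw [latticeDist, EuclideanSpace.norm_eq]
  rw [Real.sqrt_le_left (by positivity)]
  have : ∀ i, ‖((u i : ℝ) - (v i : ℝ))‖ ^ 2 ≤ (2 * D') ^ 2 := by
    intro i
    rw [Real.norm_eq_abs]
    have h1 := key hD hu i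
    have h2 := key hD' hv i
    have := abs_sub (u i : ℝ) (v i : ℝ)
    gcongr
    linarith
  refine (Finset.sum_le_sum fun i _ => this i).trans ?_
  rw [Finset.sum_const, Finset.card_univ, Fintype.card_fin, nsmul_eq_mul]
  have hdd : (d : ℝ) ≤ d ^ 2 := by exact_mod_cast Nat.le_self_pow two_ne_zero d
  calc (d : ℝ) * (2 * D') ^ 2 ≤ d ^ 2 * (2 * D') ^ 2 := by gcongr
    _ = _ := by ring

/-- The connection probability is bounded below if the product of the weights is comparable to the
`α`-th power of the distance. -/
theorem le_connProb {d : ℕ} {lam α κ y y' : ℝ} (hlam : 0 ≤ lam) {w : (Fin d → ℤ) → ℝ}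
    {u v : Fin d → ℤ} (hy : 0 ≤ y) (hy' : 0 ≤ y') (hu : y ≤ w u) (hv : y' ≤ w v)
    (hκ : κ ≤ lam * (y * y') / latticeDist u v ^ α) :
    1 - Real.exp (-κ) ≤ connProb lam α w s(u, v) := by
  rw [connProb_mk]
  split_ifs
  · linarith [Real.exp_pos (-κ)]
  · have := latticeDist_nonneg u v
    have hww : y * y' ≤ w u * w v := mul_le_mul hu hv hy' (hy.trans hu)
    have : κ ≤ lam * (w u * w v) / latticeDist u v ^ α := hκ.trans (by gcongr)
    gcongr

theorem one_sub_pow_le_exp {t : ℝ} (ht : t ≤ 1) (n : ℕ) :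
    (1 - t) ^ n ≤ Real.exp (-(t * n)) := by
  calc (1 - t) ^ n ≤ Real.exp (-t) ^ n :=
        pow_le_pow_left₀ (by linarith) (Real.one_sub_le_exp_neg t) n
    _ = _ := by rw [← Real.exp_nat_mul]; congr 1; ring

namespace IsWeightedScaleFreePercolation

variable {d : ℕ} {Ω : Type*} [MeasurableSpace Ω] {μ : Measure Ω} [IsProbabilityMeasure μ]
  {lam α : ℝ} {PW PL : Measure ℝ} [IsProbabilityMeasure PL] {W : (Fin d → ℤ) → Ω → ℝ}
  {G : Ω → SimpleGraph (Fin d → ℤ)} {L : Sym2 (Fin d → ℤ) → Ω → ℝ}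

omit [IsProbabilityMeasure μ] [IsProbabilityMeasure PL] in
theorem measureReal_weight_ge (h : IsWeightedScaleFreePercolation μ lam α PW PL W G L)
    (v : Fin d → ℤ) (y : ℝ) : μ.real {ω | y ≤ W v ω} = PW.real (Set.Ici y) := by
  rw [← h.law_weight v, measureReal_def, measureReal_def,
    Measure.map_apply (h.measurable_weight v) measurableSet_Ici]
  rfl

omit [IsProbabilityMeasure PL] in
/-- The probability that none of the vertices of `S` has weight at least `y`. -/
theorem measureReal_forall_weight_lt_le
    (h : IsWeightedScaleFreePercolation μ lam α PW PL W G L) (S : Finset (Fin d → ℤ)) (y : ℝ) :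
    μ.real {ω | ∀ v ∈ S, ¬ y ≤ W v ω} ≤ Real.exp (-(PW.real (Set.Ici y) * S.card)) := by
  have hset : {ω | ∀ v ∈ S, ¬ y ≤ W v ω} = ⋂ v ∈ S, W v ⁻¹' Set.Iio y := by
    ext; simp
  rw [hset, measureReal_def,
    h.indep_weight.measure_inter_preimage_eq_mul S fun _ _ => measurableSet_Iio,
    ENNReal.toReal_prod]
  have hone : PW.real (Set.Ici y) ≤ 1 := by
    rw [← h.measureReal_weight_ge 0]; exact measureReal_le_one
  have : ∀ v ∈ S, (μ (W v ⁻¹' Set.Iio y)).toReal = 1 - PW.real (Set.Ici y) := by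
    intro v _
    rw [← h.measureReal_weight_ge v, ← probReal_compl_eq_one_sub
      (measurableSet_le measurable_const (h.measurable_weight v)), measureReal_def]
    congr 2
    ext; simp
  rw [Finset.prod_congr rfl this, Finset.prod_const]
  exact one_sub_pow_le_exp hone _

/-- The probability that `u` has weight at least `y`, but no edge with length in `B` to a vertex
of `S` with weight at least `y'`. -/
theorem measureReal_forall_not_adj_le
    (h : IsWeightedScaleFreePercolation μ lam α PW PL W G L) (hlam : 0 ≤ lam)
    (hW1 : ∀ᵐ w ∂PW, 1 ≤ w) {u : Fin d → ℤ} {S : Finset (Fin d → ℤ)} (huS : u ∉ S) {y y' κ : ℝ}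
    (hy : 0 ≤ y) (hy' : 0 ≤ y') (hκ0 : 0 ≤ κ)
    (hκ : ∀ v ∈ S, κ ≤ lam * (y * y') / latticeDist u v ^ α) {B : Set ℝ} (hB : MeasurableSet B) :
    μ.real ({ω | y ≤ W u ω} ∩
        {ω | ∀ v ∈ S, ¬ (y' ≤ W v ω ∧ (G ω).Adj u v ∧ L s(u, v) ω ∈ B)})
      ≤ Real.exp (-((1 - Real.exp (-κ)) * PL.real B * PW.real (Set.Ici y') * S.card)) := by
  classical
  set A : Set Ω := {ω | y ≤ W u ω}
  have hmeasW : ∀ v, Measurable[weightSigma W] (W v) := fun v s hs =>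
    ⟨(fun w => w v) ⁻¹' s, measurable_pi_apply v hs, rfl⟩
  have hA : MeasurableSet[weightSigma W] A := hmeasW u measurableSet_Ici
  set D : Sym2 (Fin d → ℤ) → Set Ω := fun e => ⋃ v ∈ S, {ω | s(u, v) = e ∧ y' ≤ W v ω}
  have hDmem : ∀ v ∈ S, ∀ ω, ω ∈ D s(u, v) ↔ y' ≤ W v ω := by
    intro v hv ω
    simp only [D, Set.mem_iUnion, Set.mem_ofPred_eq, exists_prop]
    constructor
    · rintro ⟨v', -, hvv, hW⟩
      rwa [← Sym2.congr_right.1 hvv]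
    · exact fun hW => ⟨v, hv, rfl, hW⟩
  have hD : ∀ e, MeasurableSet[weightSigma W] (D e) := by
    intro e
    refine S.measurableSet_biUnion fun v _ => ?_
    by_cases he : s(u, v) = e
    · simp only [he, true_and]
      exact hmeasW v measurableSet_Ici
    · simp only [he, false_and, Set.ofPred_false, MeasurableSet.empty]
  set T := S.image fun v => s(u, v)
  have hT : ∀ e ∈ T, ¬ e.IsDiag := by
    intro e he
    obtain ⟨v, hv, rfl⟩ := Finset.mem_image.1 he
    rw [Sym2.mk_isDiag_iff]
    rintro rfl
    exact huS hv
  have hset : A ∩ {ω | ∀ v ∈ S, ¬ (y' ≤ W v ω ∧ (G ω).Adj u v ∧ L s(u, v) ω ∈ B)}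
      = A ∩ {ω | ∀ e ∈ T, ¬ (ω ∈ D e ∧ e ∈ (G ω).edgeSet ∧ L e ω ∈ B)} := by
    ext ω
    simp only [T, Set.mem_inter_iff, Set.mem_ofPred_eq, Finset.forall_mem_image]
    refine and_congr_right fun _ => forall₂_congr fun v hv => ?_
    rw [hDmem v hv, SimpleGraph.mem_edgeSet]
  rw [hset, h.measureReal_forall_not_edge hlam hW1 hT hA hD hB]
  set p := (1 - Real.exp (-κ)) * PL.real B with hp
  have hp0 : 0 ≤ p := mul_nonneg (by simpa using hκ0) measureReal_nonneg
  have hp1 : p ≤ 1 := mul_le_one₀ (by linarith [Real.exp_pos (-κ)]) measureReal_nonneg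
    measureReal_le_one
  set g : ℝ → ℝ := fun w => 1 - (Set.Ici y').indicator (fun _ => p) w
  have hg01 : ∀ w, g w ∈ Set.Icc 0 1 := by
    intro w
    simp only [g, Set.indicator_apply]
    split_ifs
    · exact ⟨by linarith, by linarith⟩
    · simp
  have hgm : Measurable g := (measurable_const.indicator measurableSet_Ici).const_sub 1
  have hgi : Integrable (fun ω => ∏ v ∈ S, g (W v ω)) μ := by
    refine Integrable.of_bound (C := 1) (Finset.measurable_prod _ fun v _ =>
      hgm.comp (h.measurable_weight v)).aestronglyMeasurable (Eventually.of_forall fun ω => ?_)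
    rw [Real.norm_of_nonneg (Finset.prod_nonneg fun v _ => (hg01 _).1)]
    exact Finset.prod_le_one (fun v _ => (hg01 _).1) fun v _ => (hg01 _).2
  have hW := h.ae_weight hW1
  have hle : ∀ᵐ ω ∂μ.restrict A, ∏ e ∈ T, (1 - (D e).indicator
      (fun ω => connProb lam α (fun x => W x ω) e * PL.real B) ω) ∈
        Set.Icc 0 (∏ v ∈ S, g (W v ω)) := by
    filter_upwards [ae_restrict_of_ae hW, ae_restrict_mem (h.weightSigma_le _ hA)] with ω hω hωA
    rw [Finset.prod_image fun v _ v' _ hvv => Sym2.congr_right.1 hvv]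
    have hfac : ∀ v ∈ S, 0 ≤ 1 - (D s(u, v)).indicator
        (fun ω => connProb lam α (fun x => W x ω) s(u, v) * PL.real B) ω ∧
        1 - (D s(u, v)).indicator
        (fun ω => connProb lam α (fun x => W x ω) s(u, v) * PL.real B) ω ≤ g (W v ω) := by
      intro v hv
      have hc := connProb_mem_Icc (α := α) hlam (fun x => zero_le_one.trans (hω x)) s(u, v)
      by_cases hvy : y' ≤ W v ω
      · rw [Set.indicator_of_mem ((hDmem v hv ω).2 hvy)]
        simp only [g]
        rw [Set.indicator_of_mem (Set.mem_Ici.2 hvy)]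
        have h1 := le_connProb (w := fun x => W x ω) hlam hy hy' hωA hvy (hκ v hv)
        have h2 := mul_le_mul_of_nonneg_right h1 (measureReal_nonneg (μ := PL) (s := B))
        have h3 := mul_le_one₀ hc.2 (measureReal_nonneg (μ := PL) (s := B)) measureReal_le_one
        exact ⟨by linarith, by linarith⟩
      · rw [Set.indicator_of_notMem fun hc => hvy ((hDmem v hv ω).1 hc)]
        simp only [g]
        rw [Set.indicator_of_notMem (s := Set.Ici y') hvy]
        simp
    exact ⟨Finset.prod_nonneg fun v hv => (hfac v hv).1,
      Finset.prod_le_prod (fun v hv => (hfac v hv).1) fun v hv => (hfac v hv).2⟩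
  have hEg : ∀ v, ∫ ω, g (W v ω) ∂μ = 1 - p * PW.real (Set.Ici y') := by
    intro v
    have hi : Integrable ({ω | y' ≤ W v ω}.indicator fun _ => p) μ :=
      (integrable_const p).indicator (measurableSet_le measurable_const (h.measurable_weight v))
    have : (fun ω => g (W v ω)) = fun ω => 1 - {ω | y' ≤ W v ω}.indicator (fun _ => p) ω := rfl
    rw [this, integral_sub (integrable_const _) hi, integral_indicator
      (measurableSet_le measurable_const (h.measurable_weight v)), setIntegral_const,
      h.measureReal_weight_ge]
    simp [mul_comm]
  have hprod : ∫ ω, ∏ v ∈ S, g (W v ω) ∂μ = (1 - p * PW.real (Set.Ici y')) ^ S.card := by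
    have hind := h.indep_weight.precomp (Subtype.val_injective (p := (· ∈ S)))
    have hS := hind.integral_fun_prod_comp
      (f := fun _ => g) (fun v => (h.measurable_weight v).aemeasurable)
      (fun v => hgm.aestronglyMeasurable)
    simp only [hEg, Finset.prod_const, Finset.card_univ,
      Fintype.card_coe] at hS
    rw [← hS]
    refine integral_congr_ae (Eventually.of_forall fun ω => ?_)
    exact (Finset.prod_coe_sort S fun v => g (W v ω)).symm
  have hone : p * PW.real (Set.Ici y') ≤ 1 := by
    rw [← h.measureReal_weight_ge 0]; exact mul_le_one₀ hp1 measureReal_nonneg measureReal_le_one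
  calc _ ≤ ∫ ω in A, ∏ v ∈ S, g (W v ω) ∂μ :=
        integral_mono_of_nonneg (hle.mono fun ω hω => hω.1) hgi.restrict
          (hle.mono fun ω hω => hω.2)
    _ ≤ ∫ ω, ∏ v ∈ S, g (W v ω) ∂μ := setIntegral_le_integral hgi
        (Eventually.of_forall fun ω => Finset.prod_nonneg fun v _ => (hg01 _).1)
    _ ≤ _ := by rw [hprod]; exact one_sub_pow_le_exp hone _

omit [IsProbabilityMeasure μ] in
/-- The Borel–Cantelli lemma for events whose probabilities decay doubly exponentially. -/
theorem ae_eventually_of_measureReal_le [IsFiniteMeasure μ] {bad : ℕ → Set Ω} {C b : ℝ}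
    (hb : 1 < b) (hbad : ∀ k, μ.real (bad k) ≤ C * Real.exp (-b ^ k)) :
    ∀ᵐ ω ∂μ, ∀ᶠ k in atTop, ω ∉ bad k := by
  refine ae_eventually_notMem ?_
  have hs :=
    ((summable_pow_mul_exp_neg (Q := 1) zero_le_one one_pos hb).mul_left C).tsum_ofReal_ne_top
  refine ((ENNReal.tsum_le_tsum fun k => ?_).trans_lt hs.lt_top).ne
  rw [← ENNReal.ofReal_toReal (measure_ne_top μ _)]
  refine ENNReal.ofReal_le_ofReal ((hbad k).trans (le_of_eq ?_))
  simp

/-- Eventually, the cube of side `exp (ρ * b ^ k)` contains vertices of weight `exp (b ^ k)`, and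
each of them has a short edge to a vertex of weight `exp (b ^ (k + 1))` in the next cube. -/
theorem ae_eventually_exists_greedy_step
    (h : IsWeightedScaleFreePercolation μ lam α PW PL W G L) (hd : 1 ≤ d) (hlam : 0 < lam)
    (hα : 0 < α) (hW1 : ∀ᵐ w ∂PW, 1 ≤ w) {c θ b ρ η : ℝ}
    (hc : 0 < c) (htl : ∀ t : ℝ, 1 ≤ t → c * t ^ (-θ) ≤ PW.real (Set.Ici t)) (hb : 1 < b)
    (hρ : α * b * ρ = 1 + b) (hη0 : 0 < η) (hη : ρ * d = θ + 2 * η) :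
    ∀ᵐ ω ∂μ, ∀ᶠ k : ℕ in atTop,
      (∃ u ∈ cube d (Real.exp (ρ * b ^ k)), Real.exp (b ^ k) ≤ W u ω) ∧
      ∀ u ∈ cube d (Real.exp (ρ * b ^ k)), Real.exp (b ^ k) ≤ W u ω →
        ∃ v ∈ cube d (Real.exp (ρ * b ^ (k + 1))), Real.exp (b ^ (k + 1)) ≤ W v ω ∧
          (G ω).Adj u v ∧ L s(u, v) ω ≤ quantile PL (Real.exp (-(η * b ^ (k + 1)))) := by
  have hb0 : 0 < b := by linarith
  have hd0 : (0 : ℝ) < d := by exact_mod_cast hd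
  have hρ0 : 0 < ρ := by
    by_contra! hcon
    have : α * b * ρ ≤ 0 := mul_nonpos_of_nonneg_of_nonpos (by positivity) hcon
    linarith
  have hD1 : ∀ k : ℕ, 1 ≤ Real.exp (ρ * b ^ k) := fun k => Real.one_le_exp (by positivity)
  have hDd : ∀ k : ℕ, Real.exp (ρ * b ^ k) ^ d = Real.exp (ρ * d * b ^ k) := fun k => by
    rw [← Real.exp_nat_mul]; congr 1; ring
  have hT : ∀ k : ℕ, c * Real.exp (-(θ * b ^ k)) ≤ PW.real (Set.Ici (Real.exp (b ^ k))) := by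
    intro k
    refine le_trans (le_of_eq ?_) (htl _ (Real.one_le_exp (by positivity)))
    rw [← Real.exp_mul]; congr 2; ring
  have hcard : ∀ k : ℕ, Real.exp (ρ * d * b ^ k) ≤ (cube d (Real.exp (ρ * b ^ k))).card :=
    fun k => hDd k ▸ pow_le_card_cube d (Real.exp_pos _).le
  have hfirst : ∀ᵐ ω ∂μ, ∀ᶠ k : ℕ in atTop, ω ∉
      {ω | ∀ u ∈ cube d (Real.exp (ρ * b ^ k)), ¬ Real.exp (b ^ k) ≤ W u ω} := by
    obtain ⟨C, -, hC⟩ := exists_exp_mul_exp_neg_exp_le 0 hc (η := 2 * η) (by positivity)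
    refine ae_eventually_of_measureReal_le hb (C := C) fun k => ?_
    refine (h.measureReal_forall_weight_lt_le _ _).trans ?_
    have := hC (b ^ k) (by positivity)
    rw [zero_mul, Real.exp_zero, one_mul] at this
    refine le_trans (Real.exp_le_exp.2 (neg_le_neg ?_)) this
    calc c * Real.exp (2 * η * b ^ k)
        = c * Real.exp (-(θ * b ^ k)) * Real.exp (ρ * d * b ^ k) := by
          rw [mul_assoc c (Real.exp _), ← Real.exp_add, hη]; congr 2; ring
      _ ≤ _ := by
          refine mul_le_mul (hT k) (hcard k) (Real.exp_pos _).le measureReal_nonneg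
  set κ := lam / (2 * d) ^ α
  have hκ0 : 0 < κ := by positivity
  set p := 1 - Real.exp (-κ) with hpdef
  have hp : 0 < p := by rw [hpdef]; simpa using hκ0
  have hsecond : ∀ᵐ ω ∂μ, ∀ᶠ k : ℕ in atTop, ω ∉
      ⋃ u ∈ cube d (Real.exp (ρ * b ^ k)), ({ω | Real.exp (b ^ k) ≤ W u ω} ∩
        {ω | ∀ v ∈ (cube d (Real.exp (ρ * b ^ (k + 1)))).erase u,
          ¬ (Real.exp (b ^ (k + 1)) ≤ W v ω ∧ (G ω).Adj u v ∧
            L s(u, v) ω ∈ Set.Iic (quantile PL (Real.exp (-(η * b ^ (k + 1))))))}) := by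
    obtain ⟨C, hC0, hC⟩ := exists_exp_mul_exp_neg_exp_le (ρ * d) (c := p * c / 2)
      (by positivity) hη0
    refine ae_eventually_of_measureReal_le hb (C := 3 ^ d * C) fun k => ?_
    set X : ℝ := b ^ (k + 1) with hX
    have hbX : b ^ k ≤ X := pow_le_pow_right₀ hb.le (Nat.le_succ k)
    have hX0 : 0 < X := by positivity
    have hbk : (0 : ℝ) < b ^ k := by positivity
    have hDD : Real.exp (ρ * b ^ k) ≤ Real.exp (ρ * X) := Real.exp_le_exp.2 (by gcongr)
    have hF : Real.exp (-(η * X)) ≤ PL.real (Set.Iic (quantile PL (Real.exp (-(η * X))))) :=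
      le_measureReal_Iic_quantile (by simpa using by positivity)
    have hone : ∀ u ∈ cube d (Real.exp (ρ * b ^ k)), μ.real ({ω | Real.exp (b ^ k) ≤ W u ω} ∩
        {ω | ∀ v ∈ (cube d (Real.exp (ρ * X))).erase u,
          ¬ (Real.exp X ≤ W v ω ∧ (G ω).Adj u v ∧
            L s(u, v) ω ∈ Set.Iic (quantile PL (Real.exp (-(η * X)))))})
        ≤ Real.exp (-(p * c / 2 * Real.exp (η * X))) := by
      intro u hu
      refine (h.measureReal_forall_not_adj_le hlam.le hW1 (Finset.notMem_erase _ _)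
        (Real.exp_pos _).le (Real.exp_pos _).le hκ0.le ?_ measurableSet_Iic).trans ?_
      · -- the side of the cube is chosen so that the connection probability is bounded below
        intro v hv
        obtain ⟨hvu, hv⟩ := Finset.mem_erase.1 hv
        have h1 := latticeDist_le_of_mem_cube (Real.exp_pos _).le hDD hu hv
        have h2 := one_le_latticeDist (Ne.symm hvu)
        have h3 : latticeDist u v ^ α
            ≤ (2 * d) ^ α * (Real.exp (b ^ k) * Real.exp X) := by
          refine (Real.rpow_le_rpow (by linarith) h1 hα.le).trans (le_of_eq ?_)
          rw [Real.mul_rpow (by positivity) (Real.exp_pos _).le, ← Real.exp_mul, ← Real.exp_add]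
          congr 2
          rw [hX, pow_succ]
          linear_combination b ^ k * hρ
        rw [le_div_iff₀ (Real.rpow_pos_of_pos (by linarith) _)]
        refine (mul_le_mul_of_nonneg_left h3 hκ0.le).trans (le_of_eq ?_)
        simp only [κ]
        field_simp
      · refine Real.exp_le_exp.2 (neg_le_neg ?_)
        have hcard2 : Real.exp (ρ * d * X) / 2 ≤ ((cube d (Real.exp (ρ * X))).erase u).card := by
          have h1 := hcard (k + 1)
          have h2 := two_le_card_cube hd (hD1 (k + 1))
          rw [← hX] at h1 h2
          have h3 := Finset.pred_card_le_card_erase (s := cube d (Real.exp (ρ * X))) (a := u)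
          have h4 : ((cube d (Real.exp (ρ * X))).card : ℝ)
              ≤ ((cube d (Real.exp (ρ * X))).erase u).card + 1 := by
            exact_mod_cast (by omega)
          have h5 : (2 : ℝ) ≤ (cube d (Real.exp (ρ * X))).card := by exact_mod_cast h2
          linarith
        calc p * c / 2 * Real.exp (η * X)
            = p * Real.exp (-(η * X)) * (c * Real.exp (-(θ * X)))
              * (Real.exp (ρ * d * X) / 2) := by
              have : Real.exp (η * X)
                  = Real.exp (-(η * X)) * Real.exp (-(θ * X)) * Real.exp (ρ * d * X) := by
                rw [← Real.exp_add, ← Real.exp_add, hη]; congr 1; ring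
              rw [this]; ring
          _ ≤ _ := by
              have := hT (k + 1)
              rw [← hX] at this
              gcongr
    refine (measureReal_biUnion_finset_le _ _).trans ((Finset.sum_le_sum hone).trans ?_)
    rw [Finset.sum_const, nsmul_eq_mul]
    have h1 : ((cube d (Real.exp (ρ * b ^ k))).card : ℝ) ≤ 3 ^ d * Real.exp (ρ * d * X) := by
      refine (card_cube_le d (hD1 k)).trans ?_
      rw [hDd]
      gcongr
    calc _ ≤ 3 ^ d * Real.exp (ρ * d * X) * Real.exp (-(p * c / 2 * Real.exp (η * X))) := by gcongr
      _ ≤ 3 ^ d * (C * Real.exp (-X)) := by 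
          rw [mul_assoc]
          exact mul_le_mul_of_nonneg_left (hC X hX0.le) (by positivity)
      _ ≤ 3 ^ d * C * Real.exp (-b ^ k) := by rw [mul_assoc]; gcongr
  filter_upwards [hfirst, hsecond] with ω h1 h2
  filter_upwards [h1, h2] with k hk1 hk2
  simp only [not_forall, not_not, exists_prop] at hk1
  refine ⟨hk1, fun u hu huW => ?_⟩
  by_contra! hcon
  refine hk2 (Set.mem_biUnion hu ⟨huW, fun v hv hbad => ?_⟩)
  exact not_le.2 (hcon v (Finset.mem_of_mem_erase hv) hbad.1 hbad.2.1) hbad.2.2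

/-- The greedy path through vertices of doubly exponentially growing weights: its length is a sum
of quantiles. -/
theorem ae_exists_lDist_le
    (h : IsWeightedScaleFreePercolation μ lam α PW PL W G L) (hd : 1 ≤ d) (hlam : 0 < lam)
    (hα : 0 < α) (hW1 : ∀ᵐ w ∂PW, 1 ≤ w) {c θ b ρ η : ℝ}
    (hc : 0 < c) (htl : ∀ t : ℝ, 1 ≤ t → c * t ^ (-θ) ≤ PW.real (Set.Ici t)) (hb : 1 < b)
    (hρ : α * b * ρ = 1 + b) (hη0 : 0 < η) (hη : ρ * d = θ + 2 * η) (x : Fin d → ℤ) :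
    ∀ᵐ ω ∂μ, ∃ C : ℝ≥0, ∀ᶠ m : ℕ in atTop, ∃ v, Real.exp (b ^ m) ≤ W v ω ∧
      lDist (G ω) (fun e => L e ω) x v
        ≤ C + ∑ k ∈ Finset.Icc 1 m, ENNReal.ofReal (quantile PL (Real.exp (-(η * b ^ k)))) := by
  filter_upwards [h.ae_eventually_exists_greedy_step hd hlam hα hW1 hc htl hb hρ hη0 hη,
    h.ae_connected] with ω hω hG
  obtain ⟨k₀, hk₀⟩ := eventually_atTop.1 hω
  obtain ⟨u₀, hu₀, hu₀W⟩ := (hk₀ k₀ le_rfl).1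
  refine ⟨(lDist (G ω) (fun e => L e ω) x u₀).toNNReal, ?_⟩
  rw [ENNReal.coe_toNNReal (lDist_lt_top (hG.preconnected x u₀)).ne]
  suffices H : ∀ m, k₀ ≤ m → ∃ v ∈ cube d (Real.exp (ρ * b ^ m)), Real.exp (b ^ m) ≤ W v ω ∧
      lDist (G ω) (fun e => L e ω) x v ≤ lDist (G ω) (fun e => L e ω) x u₀
        + ∑ k ∈ Finset.Icc 1 m, ENNReal.ofReal (quantile PL (Real.exp (-(η * b ^ k)))) by
    filter_upwards [eventually_ge_atTop k₀] with m hm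
    obtain ⟨v, -, hv⟩ := H m hm
    exact ⟨v, hv⟩
  intro m hm
  induction m, hm using Nat.le_induction with
  | base => exact ⟨u₀, hu₀, hu₀W, le_self_add⟩
  | succ m hm ih =>
    obtain ⟨u, hu, huW, hul⟩ := ih
    obtain ⟨v, hv, hvW, hadj, hL⟩ := (hk₀ m hm).2 u hu huW
    refine ⟨v, hv, hvW, (lDist_le_add_of_adj hadj).trans ?_⟩
    rw [Finset.sum_Icc_succ_top (by omega), ← add_assoc]
    exact add_le_add hul (ENNReal.ofReal_le_ofReal hL)

end IsWeightedScaleFreePercolation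

/-! ### Asymptotics of the distance to the spheres -/

/-- The bounds `S n / r - C ≤ R n ≤ r ^ 2 * S n + C` for `r` arbitrarily close to `1` give
`R n / S n → 1`, since `S n → ∞` absorbs the constants. -/
theorem tendsto_div_of_forall_bounds {S R : ℕ → ℝ} (hS : Tendsto S atTop atTop)
    (hR : ∀ i : ℕ, ∃ C : ℝ, ∀ᶠ n in atTop, S n / (1 + 1 / ((i : ℝ) + 1)) - C ≤ R n ∧
      R n ≤ (1 + 1 / ((i : ℝ) + 1)) ^ 2 * S n + C) :
    Tendsto (fun n => R n / S n) atTop (𝓝 1) := by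
  have hr : Tendsto (fun i : ℕ => 1 + 1 / ((i : ℝ) + 1)) atTop (𝓝 1) := by
    simpa using tendsto_one_div_add_atTop_nhds_zero_nat.const_add (1 : ℝ)
  have hr1 : Tendsto (fun i : ℕ => 1 / (1 + 1 / ((i : ℝ) + 1))) atTop (𝓝 1) := by
    simpa using hr.inv₀ one_ne_zero
  have hr2 : Tendsto (fun i : ℕ => (1 + 1 / ((i : ℝ) + 1)) ^ 2) atTop (𝓝 1) := by
    simpa using hr.pow 2
  have hCS : ∀ C : ℝ, Tendsto (fun n => C / S n) atTop (𝓝 0) := fun C => hS.const_div_atTop C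
  rw [tendsto_order]
  constructor
  · intro l hl
    obtain ⟨i, hi⟩ := (hr1.eventually_const_lt hl).exists
    obtain ⟨C, hC⟩ := hR i
    have := (hCS C).const_sub (1 / (1 + 1 / ((i : ℝ) + 1)))
    rw [sub_zero] at this
    filter_upwards [hC, this.eventually_const_lt hi, hS.eventually_gt_atTop 0] with n h1 h2 h3
    refine h2.trans_le ?_
    rw [le_div_iff₀ h3, sub_mul, div_mul_cancel₀ _ h3.ne']
    refine le_trans (le_of_eq ?_) h1.1
    ring
  · intro u hu
    obtain ⟨i, hi⟩ := (hr2.eventually_lt_const hu).exists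
    obtain ⟨C, hC⟩ := hR i
    have := (hCS C).const_add ((1 + 1 / ((i : ℝ) + 1)) ^ 2)
    rw [add_zero] at this
    filter_upwards [hC, this.eventually_lt_const hi, hS.eventually_gt_atTop 0] with n h1 h2 h3
    refine lt_of_le_of_lt ?_ h2
    rw [div_le_iff₀ h3, add_mul, div_mul_cancel₀ _ h3.ne']
    exact h1.2

namespace IsWeightedScaleFreePercolation

variable {d : ℕ} {Ω : Type*} [MeasurableSpace Ω] {μ : Measure Ω} [IsProbabilityMeasure μ]
  {lam α τ : ℝ} {PW PL : Measure ℝ} [IsProbabilityMeasure PW] [IsProbabilityMeasure PL]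
  {ℓ : ℝ → ℝ} {W : (Fin d → ℤ) → Ω → ℝ}
  {G : Ω → SimpleGraph (Fin d → ℤ)} {L : Sym2 (Fin d → ℤ) → Ω → ℝ}

omit [IsProbabilityMeasure PL] [IsProbabilityMeasure PW] in
/-- The exponents used in the first moment bounds; they exist as soon as `b * (γ - 1) > 1`, where
`γ = α * (τ - 1) / d`. -/
theorem exists_exponents (hd : 1 ≤ d) (hα : (d : ℝ) < α)
    (hγ2 : α * (τ - 1) / d < 2) {b : ℝ} (hb0 : 0 < b)
    (hb : 1 < b * (α * (τ - 1) / d - 1)) :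
    ∃ s β : ℝ, 0 ≤ s ∧ s ≤ 1 ∧ s ≤ β ∧ β ≤ 2 * s ∧ d < α * s ∧ (b + 1) * s < b * β ∧ 0 < β ∧
      β < τ - 1 := by
  have hd0 : (0 : ℝ) < d := by exact_mod_cast hd
  have hα0 : 0 < α := hd0.trans hα
  have h1 : (d : ℝ) / α < min 1 (b * (τ - 1) / (b + 1)) := by
    refine lt_min ((div_lt_one hα0).2 hα) ?_
    rw [div_lt_div_iff₀ hα0 (by linarith)]
    have e : b * (α * (τ - 1) / d - 1) * d = b * (τ - 1) * α - b * d := by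
      field_simp
    have := mul_lt_mul_of_pos_right hb hd0
    rw [e] at this
    linarith
  obtain ⟨s, hs1, hs2⟩ := exists_between h1
  have hs0 : 0 < s := lt_trans (by positivity) hs1
  have h2 : (b + 1) * s / b < τ - 1 := by
    rw [div_lt_iff₀ hb0]
    have := (lt_div_iff₀ (by linarith)).1 (hs2.trans_le (min_le_right _ _))
    linarith
  obtain ⟨β, hβ1, hβ2⟩ := exists_between h2
  rw [div_lt_iff₀ hb0] at hβ1
  have hsβ : s < β := by
    by_contra! hcon
    have := mul_le_mul_of_nonneg_left hcon hb0.le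
    linarith
  rw [div_lt_iff₀ hα0] at hs1
  refine ⟨s, β, hs0.le, (hs2.trans_le (min_le_left _ _)).le, hsβ.le, ?_, by linarith,
    by linarith, hs0.trans hsβ, hβ2⟩
  rw [div_lt_iff₀ hd0] at hγ2
  by_contra! hcon
  have : α * (2 * s) < α * (τ - 1) := mul_lt_mul_of_pos_left (hcon.trans hβ2) hα0
  linarith

/-- Lower bound for the distance to the spheres. -/
theorem ae_exists_le_hitSphere (h : IsWeightedScaleFreePercolation μ lam α PW PL W G L)
    (hd : 1 ≤ d) (hlam : 0 < lam) (hα : (d : ℝ) < α)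
    (hγ2 : α * (τ - 1) / d < 2) (hℓ : SlowlyVarying ℓ)
    (htail : ∀ t : ℝ, 0 < t → PW.real (Set.Ioi t) = ℓ t / t ^ (τ - 1))
    (hW1 : ∀ᵐ w ∂PW, 1 ≤ w) (hL0 : ∀ᵐ s ∂PL, 0 ≤ s) {b : ℝ} (hb1 : 1 < b)
    (hb : 1 < b * (α * (τ - 1) / d - 1)) (x : Fin d → ℤ) :
    ∀ᵐ ω ∂μ, ∃ C : ℝ, ∀ n : ℕ,
      ENNReal.ofReal ((∫ y in (0)..(n * Real.log b), expQuantile PL y) / Real.log b - C)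
        ≤ hitSphere (G ω) (fun e => L e ω) x n := by
  have hb0 : 0 < b := by linarith
  obtain ⟨s, β, hs0, hs1, hsβ, hβs, hsd, hsb, hβ0, hβτ⟩ := exists_exponents hd hα hγ2 hb0 hb
  have hd0 : (0 : ℝ) < d := by exact_mod_cast hd
  have hmom := lintegral_rpow_lt_top hℓ htail hW1 hβ0 hβτ
  filter_upwards [h.ae_exists_length_ge hd hlam.le (hd0.trans hα).le hW1 hL0 hs0 hs1 hsβ hβs hsd
    hmom hb1 hsb x, h.ae_connected] with ω ⟨c, hc, hω⟩ hG
  obtain ⟨k₀, hk₀⟩ := eventually_atTop.1 hω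
  set Q : ℕ → ℝ := fun k => quantile PL (Real.exp (-(c * b ^ k)))
  have hQ0 : ∀ k, 0 ≤ Q k := fun k => quantile_nonneg hL0 (Real.exp_pos _)
  have hlogb := Real.log_pos hb1
  obtain ⟨C, hC⟩ := exists_abs_sum_sub_integral_le (expQuantile_antitone hL0)
    (expQuantile_nonneg hL0) hlogb (Real.log c)
  refine ⟨C / Real.log b + ∑ k ∈ Finset.Icc 1 k₀, Q k, fun n => ?_⟩
  set q : ℕ → ℝ≥0∞ := fun k => if k ≤ k₀ then 0 else ENNReal.ofReal (Q k)
  have hsum := sum_le_hitSphere (G := G ω) (len := fun e => L e ω) (x := x) (q := q) hG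
    (fun u v hadj hdist => by
      simp only [q]
      split_ifs with hle
      · exact zero_le
      · refine ENNReal.ofReal_le_ofReal ?_
        have := hk₀ ((G ω).dist x u) (by omega) u v hadj rfl hdist
        rwa [← hdist] at this) n
  refine le_trans ?_ hsum
  have hq : ∑ k ∈ Finset.Icc 1 n, q k
      = ENNReal.ofReal (∑ k ∈ Finset.Icc 1 n, if k ≤ k₀ then 0 else Q k) := by
    rw [ENNReal.ofReal_sum_of_nonneg fun k _ => by split_ifs <;> simp [hQ0]]
    refine Finset.sum_congr rfl fun k _ => ?_
    simp only [q]
    split_ifs <;> simp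
  rw [hq]
  refine ENNReal.ofReal_le_ofReal ?_
  have h1 : ∑ k ∈ Finset.Icc 1 n, Q k ≤ (∑ k ∈ Finset.Icc 1 n, if k ≤ k₀ then 0 else Q k)
      + ∑ k ∈ Finset.Icc 1 k₀, Q k := by
    have h2 : ∑ k ∈ Finset.Icc 1 n, (if k ≤ k₀ then Q k else 0) ≤ ∑ k ∈ Finset.Icc 1 k₀, Q k := by
      rw [← Finset.sum_filter]
      refine Finset.sum_le_sum_of_subset_of_nonneg (fun k hk => ?_) fun k _ _ => hQ0 k
      simp only [Finset.mem_filter, Finset.mem_Icc] at hk ⊢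
      omega
    have h3 : ∑ k ∈ Finset.Icc 1 n, Q k = (∑ k ∈ Finset.Icc 1 n, if k ≤ k₀ then 0 else Q k)
        + ∑ k ∈ Finset.Icc 1 n, (if k ≤ k₀ then Q k else 0) := by
      rw [← Finset.sum_add_distrib]
      refine Finset.sum_congr rfl fun k _ => ?_
      split_ifs <;> simp
    linarith
  have h4 := (abs_le.1 (hC n)).1
  simp_rw [← quantile_exp_neg_mul_pow (P := PL) hc hb0] at h4
  have h5 : (∫ y in (0)..(n * Real.log b), expQuantile PL y) / Real.log b - C / Real.log b
      ≤ ∑ k ∈ Finset.Icc 1 n, Q k := by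
    rw [← sub_div, div_le_iff₀ hlogb]
    linarith
  linarith

/-- Upper bound for the distance to the spheres: the greedy path has left the ball of radius `n`
after about `n * log b' / log b` steps. -/
theorem ae_exists_hitSphere_le (h : IsWeightedScaleFreePercolation μ lam α PW PL W G L)
    (hd : 1 ≤ d) (hlam : 0 < lam) (hα : (d : ℝ) < α)
    (hγ2 : α * (τ - 1) / d < 2) (hℓ : SlowlyVarying ℓ)
    (htail : ∀ t : ℝ, 0 < t → PW.real (Set.Ioi t) = ℓ t / t ^ (τ - 1))
    (hW1 : ∀ᵐ w ∂PW, 1 ≤ w) (hL0 : ∀ᵐ s ∂PL, 0 ≤ s) {b b' : ℝ} (hb1 : 1 < b)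
    (hb : b * (α * (τ - 1) / d - 1) < 1) (hb1' : 1 < b')
    (hb' : 1 < b' * (α * (τ - 1) / d - 1)) (x : Fin d → ℤ) :
    ∀ᵐ ω ∂μ, ∃ C : ℝ, ∀ᶠ n : ℕ in atTop, hitSphere (G ω) (fun e => L e ω) x n
      ≤ ENNReal.ofReal ((∫ y in (0)..(n * Real.log b'), expQuantile PL y) / Real.log b + C) := by
  have hb0 : 0 < b := by linarith
  have hb0' : 0 < b' := by linarith
  obtain ⟨s, β, hs0, hs1, hsβ, hβs, hsd, hsb, hβ0, hβτ⟩ := exists_exponents hd hα hγ2 hb0' hb'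
  have hd0 : (0 : ℝ) < d := by exact_mod_cast hd
  have hα0 := hd0.trans hα
  have hmom := lintegral_rpow_lt_top hℓ htail hW1 hβ0 hβτ
  -- the side of the cubes grows fast enough for them to contain many vertices of high weight
  set ρ := (1 + b) / (α * b) with hρdef
  have hρ : α * b * ρ = 1 + b := by rw [hρdef]; field_simp
  have hθ : τ - 1 < ρ * d := by
    have e : b * (α * (τ - 1) / d - 1) * d = b * (τ - 1) * α - b * d := by
      field_simp
    have h1 := mul_lt_mul_of_pos_right hb hd0
    rw [e] at h1
    rw [hρdef, div_mul_eq_mul_div, lt_div_iff₀ (by positivity)]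
    linarith
  obtain ⟨θ, hθ1, hθ2⟩ := exists_between hθ
  obtain ⟨c, hc, htl⟩ := exists_le_tail (T := fun t => PW.real (Set.Ioi t)) hℓ htail
    (fun s t hst => measureReal_mono (Set.Ioi_subset_Ioi hst)) (fun t => measureReal_nonneg)
    hθ1 (by linarith)
  set η := (ρ * d - θ) / 2 with hηdef
  have hη0 : 0 < η := by rw [hηdef]; linarith
  have hη : ρ * d = θ + 2 * η := by rw [hηdef]; ring
  filter_upwards [h.ae_exists_weight_le hd hlam.le hα0.le hW1 hs0 hs1 hsβ hβs hsd hmom hb1' hsb x,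
    h.ae_exists_lDist_le hd hlam hα0 hW1 hc
      (fun t ht => (htl t ht).trans (measureReal_mono Set.Ioi_subset_Ici_self)) hb1 hρ hη0 hη x,
    h.ae_connected] with ω ⟨j, hj⟩ ⟨C₁, hC₁⟩ hG
  have hlogb := Real.log_pos hb1
  have hlogb' := Real.log_pos hb1'
  have hanti := expQuantile_antitone (P := PL) hL0
  have hnn := expQuantile_nonneg (P := PL) hL0
  obtain ⟨C₂, hC₂⟩ := exists_abs_sum_sub_integral_le hanti hnn hlogb (Real.log η)
  set D := j * Real.log b' + Real.log b
  set E := expQuantile PL (-|D|) * |D|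
  -- the first index `m` with `b ^ m ≥ b' ^ (n + j)`, so that a vertex of weight `exp (b ^ m)` is not
  -- at distance less than `n`
  set m : ℕ → ℕ := fun n => ⌈((n : ℝ) + j) * Real.log b' / Real.log b⌉₊
  have hm : ∀ n : ℕ, ((n : ℝ) + j) * Real.log b' ≤ m n * Real.log b := fun n =>
    (div_le_iff₀ hlogb).1 (Nat.le_ceil _)
  have hm' : ∀ n : ℕ, m n * Real.log b ≤ n * Real.log b' + D := fun n => by
    have h1 := Nat.ceil_lt_add_one
      (show 0 ≤ ((n : ℝ) + j) * Real.log b' / Real.log b by positivity)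
    have h2 := mul_lt_mul_of_pos_right h1 hlogb
    rw [add_mul (_ / _), div_mul_cancel₀ _ hlogb.ne'] at h2
    simp only [D]
    linarith
  have hmtop : Tendsto m atTop atTop := by
    refine tendsto_nat_ceil_atTop.comp (Tendsto.atTop_div_const hlogb
      (Tendsto.atTop_mul_const hlogb' ?_))
    exact tendsto_atTop_add_const_right _ _ tendsto_natCast_atTop_atTop
  refine ⟨C₁ + (E + C₂) / Real.log b, ?_⟩
  filter_upwards [hmtop.eventually hC₁] with n ⟨v, hvW, hvl⟩
  have hdist : n ≤ (G ω).dist x v := by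
    by_contra! hcon
    have h1 := hvW.trans (hj v)
    rw [Real.exp_le_exp] at h1
    have h2 : b' ^ ((G ω).dist x v + j) < b' ^ (n + j) := pow_lt_pow_right₀ hb1' (by omega)
    have h3 : b' ^ (n + j) ≤ b ^ m n := by
      rw [← Real.log_le_log_iff (by positivity) (by positivity), Real.log_pow, Real.log_pow]
      exact_mod_cast hm n
    linarith
  refine (hitSphere_le_lDist (y := v) ?_).trans (hvl.trans ?_)
  · rw [← (hG.preconnected x v).coe_dist_eq_edist]
    exact_mod_cast hdist
  have hsum0 : 0 ≤ ∑ k ∈ Finset.Icc 1 (m n), quantile PL (Real.exp (-(η * b ^ k))) :=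
    Finset.sum_nonneg fun k _ => quantile_nonneg hL0 (Real.exp_pos _)
  rw [← ENNReal.ofReal_sum_of_nonneg fun k _ => quantile_nonneg hL0 (Real.exp_pos _),
    ← ENNReal.ofReal_coe_nnreal, ← ENNReal.ofReal_add C₁.coe_nonneg hsum0]
  refine ENNReal.ofReal_le_ofReal ?_
  have h4 := (abs_le.1 (hC₂ (m n))).2
  simp_rw [← quantile_exp_neg_mul_pow (P := PL) hη0 hb0] at h4
  have h5 : ∫ y in (0)..(m n * Real.log b), expQuantile PL y
      ≤ (∫ y in (0)..(n * Real.log b'), expQuantile PL y) + E := by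
    refine (integral_mono_right hanti hnn (hm' n)).trans ?_
    rw [← intervalIntegral.integral_add_adjacent_intervals
      (hanti.intervalIntegrable (a := 0) (b := n * Real.log b')) hanti.intervalIntegrable]
    have := (abs_le.1 (abs_integral_shift_le hanti hnn (a := n * Real.log b') (c := D)
      (by positivity))).2
    linarith
  have h6 : ∑ k ∈ Finset.Icc 1 (m n), quantile PL (Real.exp (-(η * b ^ k)))
      ≤ (∫ y in (0)..(n * Real.log b'), expQuantile PL y) / Real.log b
        + (E + C₂) / Real.log b := by
    rw [← add_div, le_div_iff₀ hlogb]
    linarith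
  linarith

/-- The distance to the sphere of radius `n` is `S n * (1 + o(1)) + O(1)`, where `S n` is the sum
of quantiles. -/
theorem ae_exists_hitSphere_bounds (h : IsWeightedScaleFreePercolation μ lam α PW PL W G L)
    (hd : 1 ≤ d) (hlam : 0 < lam) (hα : (d : ℝ) < α)
    (hγ1 : 1 < α * (τ - 1) / d) (hγ2 : α * (τ - 1) / d < 2) (hℓ : SlowlyVarying ℓ)
    (htail : ∀ t : ℝ, 0 < t → PW.real (Set.Ioi t) = ℓ t / t ^ (τ - 1))
    (hW1 : ∀ᵐ w ∂PW, 1 ≤ w) (hL0 : ∀ᵐ s ∂PL, 0 ≤ s) {a : ℝ} (ha1 : 1 < a)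
    (ha : a * (α * (τ - 1) / d - 1) = 1) {r : ℝ} (hr : 1 < r) (x : Fin d → ℤ) :
    ∀ᵐ ω ∂μ, ∃ C : ℝ, ∀ᶠ n : ℕ in atTop,
      ENNReal.ofReal ((∑ k ∈ Finset.Icc 1 n, quantile PL (Real.exp (-(a ^ k)))) / r - C)
        ≤ hitSphere (G ω) (fun e => L e ω) x n ∧
      hitSphere (G ω) (fun e => L e ω) x n ≤ ENNReal.ofReal
        (r ^ 2 * (∑ k ∈ Finset.Icc 1 n, quantile PL (Real.exp (-(a ^ k)))) + C) := by
  have hloga := Real.log_pos ha1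
  have hg : 0 < α * (τ - 1) / d - 1 := by linarith
  have hr0 : 0 < r := by linarith
  -- growth rates `b = a ^ (1 / r)` and `b' = a ^ r` on either side of `a`
  set b := Real.exp (Real.log a / r) with hbdef
  set b' := Real.exp (r * Real.log a) with hbdef'
  have hlogb : Real.log b = Real.log a / r := Real.log_exp _
  have hlogb' : Real.log b' = r * Real.log a := Real.log_exp _
  have hb1 : 1 < b := Real.one_lt_exp_iff.2 (by positivity)
  have hb1' : 1 < b' := Real.one_lt_exp_iff.2 (by positivity)
  have hba : b < a := by
    rw [← Real.exp_log (show 0 < a by linarith), hbdef, Real.exp_lt_exp]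
    exact div_lt_self hloga hr
  have hab' : a < b' := by
    conv_lhs => rw [← Real.exp_log (show 0 < a by linarith)]
    rw [hbdef', Real.exp_lt_exp]
    exact lt_mul_of_one_lt_left hloga hr
  have hb : b * (α * (τ - 1) / d - 1) < 1 :=
    (mul_lt_mul_of_pos_right hba hg).trans_eq ha
  have hb' : 1 < b' * (α * (τ - 1) / d - 1) :=
    ha.symm.trans_lt (mul_lt_mul_of_pos_right hab' hg)
  have hanti := expQuantile_antitone (P := PL) hL0
  have hnn := expQuantile_nonneg (P := PL) hL0
  obtain ⟨C₀, hC₀⟩ := exists_abs_sum_sub_integral_le hanti hnn hloga (Real.log 1)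
  simp_rw [← quantile_exp_neg_mul_pow (P := PL) one_pos (show 0 < a by linarith), one_mul] at hC₀
  set S : ℕ → ℝ := fun n => ∑ k ∈ Finset.Icc 1 n, quantile PL (Real.exp (-(a ^ k)))
  set I : ℕ → ℝ := fun n => ∫ y in (0)..(n * Real.log a), expQuantile PL y
  filter_upwards [h.ae_exists_le_hitSphere hd hlam hα hγ2 hℓ htail hW1 hL0 hb1' hb' x,
    h.ae_exists_hitSphere_le hd hlam hα hγ2 hℓ htail hW1 hL0 hb1 hb hb1' hb' x]
    with ω ⟨C₁, hC₁⟩ ⟨C₂, hC₂⟩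
  refine ⟨max (C₁ + C₀ / (r * Real.log a)) (C₂ + r ^ 2 * C₀ / Real.log a), ?_⟩
  filter_upwards [hC₂] with n hn
  have h0 := abs_le.1 (hC₀ n)
  constructor
  · refine le_trans (ENNReal.ofReal_le_ofReal ?_) (hC₁ n)
    rw [hlogb']
    have h1 : I n ≤ ∫ y in (0)..(n * (r * Real.log a)), expQuantile PL y := by
      refine integral_mono_right hanti hnn ?_
      have : Real.log a ≤ r * Real.log a := le_mul_of_one_le_left hloga.le hr.le
      gcongr
    have h2 : S n / r - C₀ / (r * Real.log a)
        ≤ (∫ y in (0)..(n * (r * Real.log a)), expQuantile PL y) / (r * Real.log a) := by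
      rw [le_div_iff₀ (by positivity)]
      have : (S n / r - C₀ / (r * Real.log a)) * (r * Real.log a) = Real.log a * S n - C₀ := by
        field_simp
      rw [this]
      linarith [h0.2]
    have h3 := le_max_left (C₁ + C₀ / (r * Real.log a)) (C₂ + r ^ 2 * C₀ / Real.log a)
    linarith
  · refine hn.trans (ENNReal.ofReal_le_ofReal ?_)
    rw [hlogb, hlogb']
    have h1 : ∫ y in (0)..(n * (r * Real.log a)), expQuantile PL y ≤ r * I n := by
      have := integral_mul_le hanti hr.le (X := n * Real.log a) (by positivity)
      rwa [mul_left_comm] at this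
    have h2 : (∫ y in (0)..(n * (r * Real.log a)), expQuantile PL y) / (Real.log a / r)
        ≤ r ^ 2 * S n + r ^ 2 * C₀ / Real.log a := by
      rw [div_le_iff₀ (by positivity)]
      have : (r ^ 2 * S n + r ^ 2 * C₀ / Real.log a) * (Real.log a / r)
          = r * (Real.log a * S n + C₀) := by
        field_simp
      rw [this]
      exact h1.trans (mul_le_mul_of_nonneg_left (by linarith [h0.1]) hr0.le)
    have h3 := le_max_right (C₁ + C₀ / (r * Real.log a)) (C₂ + r ^ 2 * C₀ / Real.log a)
    linarith

end IsWeightedScaleFreePercolation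

end SFP

theorem mainTheorem1 {d : ℕ} (hd : 1 ≤ d) {Ω : Type*} [MeasurableSpace Ω] (μ : Measure Ω)
    [IsProbabilityMeasure μ] (lam α τ γ : ℝ) (hlam : 0 < lam) (hα : (d : ℝ) < α) (hτ : 1 < τ)
    (hγ : γ = α * (τ - 1) / d) (hγ1 : 1 < γ) (hγ2 : γ < 2)
    (PW PL : Measure ℝ) [IsProbabilityMeasure PW] [IsProbabilityMeasure PL]
    (ℓ : ℝ → ℝ) (hℓ : SFP.SlowlyVarying ℓ)
    (htail : ∀ t : ℝ, 0 < t → PW.real (Set.Ioi t) = ℓ t / t ^ (τ - 1))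
    (hW1 : ∀ᵐ w ∂PW, 1 ≤ w) (hL0 : ∀ᵐ s ∂PL, 0 ≤ s)
    (W : (Fin d → ℤ) → Ω → ℝ) (G : Ω → SimpleGraph (Fin d → ℤ)) (L : Sym2 (Fin d → ℤ) → Ω → ℝ)
    (hSFP : SFP.IsWeightedScaleFreePercolation μ lam α PW PL W G L) (x : Fin d → ℤ) :
    (SFP.explosionIntegral PL < ∞ →
      ∃ V : Ω → ℝ≥0, Measurable V ∧
        (∀ᵐ ω ∂μ, Tendsto (fun n => SFP.hitCount (G ω) (fun e => L e ω) x n) atTop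
          (𝓝 (V ω : ℝ≥0∞))) ∧
        (∀ᵐ ω ∂μ, Tendsto (fun n => SFP.hitSphere (G ω) (fun e => L e ω) x n) atTop
          (𝓝 (V ω : ℝ≥0∞)))) ∧
    (SFP.explosionIntegral PL = ∞ →
      (∀ᵐ ω ∂μ, Tendsto (fun n => SFP.hitCount (G ω) (fun e => L e ω) x n) atTop (𝓝 ∞)) ∧
      (∀ᵐ ω ∂μ, Tendsto (fun n => SFP.hitSphere (G ω) (fun e => L e ω) x n) atTop (𝓝 ∞)) ∧
      (∀ᵐ ω ∂μ, Tendsto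
        (fun n : ℕ => SFP.hitSphere (G ω) (fun e => L e ω) x n /
          ENNReal.ofReal (∑ k ∈ Finset.Icc 1 n,
            SFP.quantile PL (Real.exp (-((1 / (γ - 1)) ^ k)))))
        atTop (𝓝 1))) := by
  have hd0 : (0 : ℝ) < d := by exact_mod_cast hd
  have hg : 0 < γ - 1 := by linarith
  set a := 1 / (γ - 1) with hadef
  have ha1 : 1 < a := by rw [hadef, lt_div_iff₀ hg]; linarith
  have ha0 : 0 < a := by linarith
  have hγ' : α * (τ - 1) / d = γ := hγ.symm
  have ha : a * (α * (τ - 1) / d - 1) = 1 := by rw [hγ', hadef]; field_simp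
  have hloga := Real.log_pos ha1
  have hanti := SFP.expQuantile_antitone (P := PL) hL0
  have hnn := SFP.expQuantile_nonneg (P := PL) hL0
  set S : ℕ → ℝ := fun n => ∑ k ∈ Finset.Icc 1 n, SFP.quantile PL (Real.exp (-(a ^ k))) with hS
  set M : Ω → ℕ → ℝ≥0∞ := fun ω => SFP.hitSphere (G ω) (fun e => L e ω) x
  set N : Ω → ℕ → ℝ≥0∞ := fun ω => SFP.hitCount (G ω) (fun e => L e ω) x
  obtain ⟨C₀, hC₀⟩ := SFP.exists_abs_sum_sub_integral_le hanti hnn hloga (Real.log 1)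
  simp_rw [← SFP.quantile_exp_neg_mul_pow (P := PL) one_pos ha0, one_mul] at hC₀
  have hbounds : ∀ r : ℝ, 1 < r → ∀ᵐ ω ∂μ, ∃ C : ℝ, ∀ᶠ n : ℕ in atTop,
      ENNReal.ofReal (S n / r - C) ≤ M ω n ∧ M ω n ≤ ENNReal.ofReal (r ^ 2 * S n + C) :=
    fun r hr => hSFP.ae_exists_hitSphere_bounds hd hlam hα (by rwa [hγ']) (by rwa [hγ']) hℓ
      htail hW1 hL0 ha1 ha hr x
  -- explosion by counting vertices and explosion by graph distance happen at the same time
  have hsup : ∀ᵐ ω ∂μ, ⨆ n, N ω n = ⨆ n, M ω n := by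
    obtain ⟨s, β, hs0, hs1, hsβ, hβs, hsd, -, hβ0, hβτ⟩ :=
      SFP.IsWeightedScaleFreePercolation.exists_exponents hd hα (b := 2 * a) (by rwa [hγ'])
        (by positivity) (by rw [mul_assoc, ha]; norm_num)
    filter_upwards [hSFP.ae_connected, hSFP.ae_locallyFinite hd hlam.le (hd0.trans hα).le hW1 hs0
      hs1 hsβ hβs hsd (SFP.lintegral_rpow_lt_top hℓ htail hW1 hβ0 hβτ)] with ω hG hfin
    exact SFP.iSup_hitCount_eq_iSup_hitSphere hG hfin x
  have hMt : ∀ ω, Tendsto (M ω) atTop (𝓝 (⨆ n, M ω n)) := fun ω =>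
    tendsto_atTop_iSup (SFP.hitSphere_mono x)
  have hNt : ∀ ω, Tendsto (N ω) atTop (𝓝 (⨆ n, N ω n)) := fun ω =>
    tendsto_atTop_iSup (SFP.hitCount_mono x)
  constructor
  · intro hI
    obtain ⟨B, hB⟩ := SFP.exists_integral_le hanti hnn hI
    have hSB : ∀ n, S n ≤ (B + C₀) / Real.log a := fun n => by
      rw [le_div_iff₀ hloga]
      have h1 := (abs_le.1 (hC₀ n)).2
      have h2 := hB (n * Real.log a) (by positivity)
      linarith
    have hfinite : ∀ᵐ ω ∂μ, ⨆ n, M ω n < ∞ := by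
      filter_upwards [hbounds 2 one_lt_two] with ω ⟨C, hC⟩
      refine lt_of_le_of_lt (le_of_tendsto (hMt ω) (hC.mono fun n hn => ?_))
        (ENNReal.ofReal_lt_top (r := 2 ^ 2 * ((B + C₀) / Real.log a) + C))
      refine hn.2.trans (ENNReal.ofReal_le_ofReal ?_)
      have := hSB n
      linarith
    -- the explosion time is taken from `hitCount`, which is plainly measurable
    refine ⟨fun ω => (⨆ n, N ω n).toNNReal, ?_, ?_, ?_⟩
    · exact (Measurable.iSup fun n => SFP.measurable_hitCount hSFP.measurableSet_edge
        hSFP.measurable_length x n).ennreal_toNNReal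
    · filter_upwards [hsup, hfinite] with ω h1 h2
      rw [ENNReal.coe_toNNReal (h1 ▸ h2.ne)]
      exact hNt ω
    · filter_upwards [hsup, hfinite] with ω h1 h2
      rw [ENNReal.coe_toNNReal (h1 ▸ h2.ne), h1]
      exact hMt ω
  · intro hI
    have hStop : Tendsto S atTop atTop := by
      have h1 := (SFP.tendsto_integral_atTop hanti hnn hI).comp
        (tendsto_natCast_atTop_atTop.atTop_mul_const hloga)
      have h2 := (tendsto_atTop_add_const_right _ (-C₀) h1).atTop_div_const hloga
      refine tendsto_atTop_mono (fun n => ?_) h2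
      rw [div_le_iff₀ hloga]
      have := (abs_le.1 (hC₀ n)).1
      simp only [Function.comp_apply]
      linarith
    have htop : ∀ᵐ ω ∂μ, ⨆ n, M ω n = ∞ := by
      filter_upwards [hbounds 2 one_lt_two] with ω ⟨C, hC⟩
      have h1 : Tendsto (fun n => ENNReal.ofReal (S n / 2 - C)) atTop (𝓝 ∞) :=
        ENNReal.tendsto_ofReal_atTop.comp
          (tendsto_atTop_add_const_right _ (-C) (hStop.atTop_div_const two_pos))
      exact top_le_iff.1 (le_of_tendsto_of_tendsto h1 (hMt ω) (hC.mono fun n hn => hn.1))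
    refine ⟨?_, ?_, ?_⟩
    · filter_upwards [hsup, htop] with ω h1 h2
      rw [← h2, ← h1]
      exact hNt ω
    · filter_upwards [htop] with ω h2
      rw [← h2]
      exact hMt ω
    · have hall := ae_all_iff.2 fun i : ℕ => hbounds (1 + 1 / ((i : ℝ) + 1))
        (by linarith [Nat.one_div_pos_of_nat (α := ℝ) (n := i)])
      filter_upwards [hall] with ω hω
      obtain ⟨C', hC'⟩ := hω 0
      have hfin : ∀ᶠ n in atTop, M ω n ≠ ∞ := hC'.mono fun n hn =>
        (hn.2.trans_lt ENNReal.ofReal_lt_top).ne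
      have hlim : Tendsto (fun n => (M ω n).toReal / S n) atTop (𝓝 1) := by
        refine SFP.tendsto_div_of_forall_bounds hStop fun i => ?_
        obtain ⟨C, hC⟩ := hω i
        refine ⟨max C 0, ?_⟩
        filter_upwards [hC, hfin, hStop.eventually_ge_atTop 0] with n h1 h2 h3
        have hmax := le_max_left C 0
        have hmax0 := le_max_right C 0
        constructor
        · have := (ENNReal.ofReal_le_iff_le_toReal h2).1 h1.1
          linarith
        · have h4 : M ω n ≤ ENNReal.ofReal ((1 + 1 / ((i : ℝ) + 1)) ^ 2 * S n + max C 0) :=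
            h1.2.trans (ENNReal.ofReal_le_ofReal (by linarith))
          exact ENNReal.toReal_le_of_le_ofReal (by positivity) h4
      have := (ENNReal.continuous_ofReal.tendsto 1).comp hlim
      rw [ENNReal.ofReal_one] at this
      refine this.congr' ?_
      filter_upwards [hfin, hStop.eventually_gt_atTop 0] with n h1 h2
      rw [Function.comp_apply, ENNReal.ofReal_div_of_pos h2, ENNReal.ofReal_toReal h1]
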